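/- Let $\mathcal X,\mathcal Y$ be Polish spaces, $p_X$ a Borel probability measure on $\mathcal X$ and $p_{Y|X}$ a Markov kernel from $\mathcal X$ to $\mathcal Y$; let $p_{XY}$ be the induced joint law, $p_Y$ its second marginal, and assume that the mutual information $I(X;Y)=D(p_{XY}\,\|\,p_X\times p_Y)$ is finite. Logarithms are to base $2$. An $n$-length code $(f,g,U)$ consists of a random variable $U$ in an arbitrary measurable space $\mathcal U$, independent of $X^n$ (the $X_i$ being i.i.d. $\sim p_X$), of an encoder $f:\mathcal X^n\times\mathcal U\to\{0,1\}^*$ such that for every $u$ the range of $f(\cdot,u)$ is prefix-free, and of a decoder $g:\{0,1\}^*\times\mathcal U\to\mathcal Y^n$. It simulates the channel if, with $Y^n=g(f(X^n,U),U)$, the pairs $(X_i,Y_i)$, $1\le i\le n$, are i.i.d. $\sim p_{XY}$. Let $$R_n=\inf_{(f,g,U)}\ \frac1n\,\mathbb E\big[\ell(f(X^n,U))\big],$$ the infimum over all $n$-length codes that simulate the channel, where $\ell$ is the length of a binary string. Let $\imath(x,y)=\log\frac{dp_{Y|X}}{dp_Y}(y|x)$. Call the channel singular if $\imath(X,Y)$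 is almost surely equal to a deterministic measurable function of $Y$, and non-singular otherwise. 1. If the channel is singular, then $$\lim_{n\to\infty}\frac{R_n-I(X;Y)}{\log n/n}=0 .$$ 2. If the channel is non-singular and $\imath(X,Y)$ has finite variance under $p_{XY}$, then $$\limsup_{n\to\infty}\frac{R_n-I(X;Y)}{\log n/n}\le\frac12 .$$ -/

import Mathlib

open MeasureTheory ProbabilityTheory Filter Topology
open scoped ENNReal

noncomputable section

namespace ChannelSynthesis

universe u v w

/-- The mutual information `I(X;Y)`, in bits, of the pair with `X ∼ μ` and channel `κ`:
the relative entropy of the joint law with respect to the product of the marginals. -/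
def mutualInfo {X : Type u} {Y : Type v} [MeasurableSpace X] [MeasurableSpace Y]
    (μ : Measure X) (κ : Kernel X Y) : ℝ≥0∞ :=
  InformationTheory.klDiv (μ ⊗ₘ κ) (μ.prod (κ ∘ₘ μ)) / ENNReal.ofReal (Real.log 2)

/-- The information density `log₂ (dp_{Y|X} / dp_Y)(y | x)`, through the jointly measurable
version of the Radon-Nikodym derivative. -/
def infoDensity {X : Type u} {Y : Type v} [MeasurableSpace X] [MeasurableSpace Y]
    [MeasurableSpace.CountableOrCountablyGenerated X Y]
    (μ : Measure X) (κ : Kernel X Y) (p : X × Y) : ℝ :=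
  Real.logb 2 (Kernel.rnDeriv κ (Kernel.const X (κ ∘ₘ μ)) p.1 p.2).toReal

/-- The joint law of source and channel is singular: the information density of `(X, Y)` is
almost surely a deterministic (measurable) function of `Y`. -/
def IsSingular {X : Type u} {Y : Type v} [MeasurableSpace X] [MeasurableSpace Y]
    [MeasurableSpace.CountableOrCountablyGenerated X Y]
    (μ : Measure X) (κ : Kernel X Y) : Prop :=
  ∃ h : Y → ℝ, Measurable h ∧ ∀ᵐ p ∂(μ ⊗ₘ κ), infoDensity μ κ p = h p.2

/-- An `n`-length code with common randomness `U ∼ ν` (an arbitrary probability space), a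
deterministic encoder whose range is prefix-free for every value of the common randomness, and a
deterministic decoder. Since there are countably many binary strings, measurability is expressed
string by string. -/
structure Code (X : Type u) (Y : Type v) [MeasurableSpace X] [MeasurableSpace Y] (n : ℕ) where
  /-- the space of the common randomness -/
  U : Type w
  /-- its sigma-algebra -/
  mU : MeasurableSpace U
  /-- the law of the common randomness -/
  ν : Measure U
  isProb : IsProbabilityMeasure ν
  /-- the encoder -/
  enc : (Fin n → X) → U → List Bool
  /-- the decoder -/
  dec : List Bool → U → (Fin n → Y)
  measurable_enc : ∀ s : List Bool, MeasurableSet {p : (Fin n → X) × U | enc p.1 p.2 = s}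
  measurable_dec : ∀ s : List Bool, Measurable (dec s)
  prefix_free : ∀ (a : U) (x x' : Fin n → X), enc x a <+: enc x' a → enc x a = enc x' a

attribute [instance] Code.mU Code.isProb

namespace Code

variable {X : Type u} {Y : Type v} [MeasurableSpace X] [MeasurableSpace Y] {n : ℕ}

/-- The code simulates the `n`-fold memoryless channel on the i.i.d. source: with `Xⁿ ∼ μⁿ`
independent of `U ∼ ν` and `Yⁿ = dec (enc Xⁿ U) U`, the pairs `(X_i, Y_i)` are i.i.d. with the
joint law of `μ` and `κ`. -/
def Simulates (c : Code.{u, v, w} X Y n) (μ : Measure X) (κ : Kernel X Y) : Prop :=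
  Measure.map (fun (p : (Fin n → X) × c.U) (i : Fin n) => (p.1 i, c.dec (c.enc p.1 p.2) p.2 i))
    ((Measure.pi fun _ : Fin n => μ).prod c.ν) = Measure.pi fun _ : Fin n => μ ⊗ₘ κ

/-- The average rate `E[ℓ(enc Xⁿ U)] / n`. -/
def rate (c : Code.{u, v, w} X Y n) (μ : Measure X) : ℝ≥0∞ :=
  (∫⁻ p, ((c.enc p.1 p.2).length : ℝ≥0∞) ∂((Measure.pi fun _ : Fin n => μ).prod c.ν)) / (n : ℝ≥0∞)

end Code

/-- The `n`-length minimum average rate: the infimum of the rates of all the codes, over all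
constructions of the common randomness, that simulate the channel. -/
def minRate {X : Type u} {Y : Type v} [MeasurableSpace X] [MeasurableSpace Y]
    (μ : Measure X) (κ : Kernel X Y) (n : ℕ) : ℝ≥0∞ :=
  ⨅ (c : Code.{u, v, max u v} X Y n) (_ : c.Simulates μ κ), c.rate μ

/-- The normalized redundancy `(R_n - I(X;Y)) / (log₂ n / n)`, as an extended real number (so that
an infinite `R_n` would count as `+∞`). -/
def normRedundancy {X : Type u} {Y : Type v} [MeasurableSpace X] [MeasurableSpace Y]
    (μ : Measure X) (κ : Kernel X Y) (n : ℕ) : EReal :=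
  ((minRate μ κ n : EReal) - (mutualInfo μ κ : EReal)) / ((Real.logb 2 n / n : ℝ) : EReal)

end ChannelSynthesis

end

/-!
The lower bound `I ≤ R_n`, needed in the singular case, is `Code.mutualInfo_le_rate`. Let `r` be the
density of the joint law with respect to the product of its marginals. For a fixed value of the
common randomness, the decoder picks one of the words attached to the codewords in the range of the
encoder, and these codewords satisfy the Kraft inequality; hence `r(Xⁿ, Yⁿ) 2^(-ℓ)` has mean at most
one. Since `log t ≤ t - 1`, the mean of `log₂ r(Xⁿ, Yⁿ) - ℓ` is at most zero.

The upper bounds come from greedy rejection sampling (`minRate_le`). The common randomness is a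
sequence of independent proposals from the output law. At each step the encoder accepts the proposal
with the largest probability for which the accepted mass stays below the target density `r(x, ·)`,
so the accepted proposal has exactly the law of the channel output given `x`. If the proposal `y` is
accepted at step `m`, when the probability of having accepted nothing so far is `s`, then
`m * s ≤ r(x, y)`, because each earlier step already offered a mass of at least `s` at `y`
(`survival_mul_le`); moreover, `log (1 / s)` has bounded mean (`tsum_allotted_div_sqrt_le`). So
`log₂ m` exceeds the information density of the block by `O(1)` in mean. More generally, the
outputs may be divided into levels and step `j ↔ (k, m)` draws its proposal from the output law
conditioned on the level `k`; then `m * s ≤ r(x, y) P(level k)`.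

If the channel is singular, the level of an output block is the integer part of its information
density (`0` if this is negative), a function of the output alone. Then `m` is at most of the order
of `2 ^ k P(level k)`, and the weights `2 ^ (-k) (N / (N + m))²` with `N = 1 + 2 ^ k P(level k)` have
a sum bounded independently of the block length. They give a code of `k + O(1)` bits, that is,
`n I + O(1)` bits in mean (`minRate_le_of_isSingular`).

In general a single level is used. The information density of the block concentrates within `O(√n)`
of `n I` by its finite variance, so that `⌊log₂ m⌋` is described by `log₂ √n + O(1)` bits, after
which `m` itself takes `log₂ m` bits: `n I + (log₂ n) / 2 + O(1)` bits in mean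
(`minRate_le_of_memLp`).
-/

noncomputable section

namespace ChannelSynthesis

universe u v w

/-! ### Prefix-free codes and the Kraft inequality -/

/-- The number in `[0, 1)` whose binary expansion is the given string. The numbers whose expansion
begins with `s` fill the interval `[binVal s, binVal s + 2⁻¹ ^ s.length)`. -/
def binVal : List Bool → ℝ
  | [] => 0
  | b :: s => ((if b then 1 else 0) + binVal s) / 2

lemma binVal_append (s t : List Bool) :
    binVal (s ++ t) = binVal s + (2⁻¹ : ℝ) ^ s.length * binVal t := by
  induction s with
  | nil => simp [binVal]
  | cons b s ih => simp only [List.cons_append, binVal, ih, List.length_cons, pow_succ]; ring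

lemma binVal_nonneg (s : List Bool) : 0 ≤ binVal s := by
  induction s with
  | nil => simp [binVal]
  | cons b s ih => cases b <;> simp [binVal] <;> linarith

lemma binVal_add_le_one (s : List Bool) : binVal s + (2⁻¹ : ℝ) ^ s.length ≤ 1 := by
  induction s with
  | nil => simp [binVal]
  | cons b s ih => cases b <;> simp only [binVal, List.length_cons, pow_succ] <;> norm_num <;> linarith

lemma exists_binVal_le (l : ℕ) (x : ℝ) (h0 : 0 ≤ x) (h1 : x < 1) :
    ∃ s : List Bool, s.length = l ∧ binVal s ≤ x ∧ x < binVal s + (2⁻¹ : ℝ) ^ l := by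
  induction l generalizing x with
  | zero => exact ⟨[], by simpa [binVal] using ⟨h0, h1⟩⟩
  | succ l ih =>
    by_cases hx : x < 1 / 2
    · obtain ⟨s, hs, h2, h3⟩ := ih (2 * x) (by linarith) (by linarith)
      rw [inv_pow] at h3
      refine ⟨false :: s, by simp [hs], ?_, ?_⟩ <;> simp [binVal, pow_succ] <;> linarith
    · obtain ⟨s, hs, h2, h3⟩ := ih (2 * x - 1) (by linarith) (by linarith)
      rw [inv_pow] at h3
      refine ⟨true :: s, by simp [hs], ?_, ?_⟩ <;> simp [binVal, pow_succ] <;> linarith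

/-- The converse of the Kraft inequality, in the form of the Shannon-Fano-Elias code: positive
weights of total mass at most one are the weights of a prefix-free code, up to two bits. -/
lemma exists_prefix_code (w : ℕ → ℝ) (hw : ∀ i, 0 < w i)
    (hsum : ∑' i, ENNReal.ofReal (w i) ≤ 1) :
    ∃ C : ℕ → List Bool, (∀ i j, C i <+: C j → i = j) ∧
      ∀ i, ((C i).length : ℝ) ≤ - Real.logb 2 (w i) + 2 := by
  set F : ℕ → ℝ := fun i => ∑ j ∈ Finset.range i, w j with hF
  have hF1 : ∀ i, F i ≤ 1 := fun i => by
    have h := (ENNReal.sum_le_tsum (Finset.range i)).trans hsum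
    rw [← ENNReal.ofReal_sum_of_nonneg fun j _ => (hw j).le] at h
    exact ENNReal.ofReal_le_one.1 h
  have hFs : ∀ i, F (i + 1) = F i + w i := fun i => Finset.sum_range_succ _ _
  have hF0 : ∀ i, 0 ≤ F i := fun i => Finset.sum_nonneg fun j _ => (hw j).le
  have hmono : Monotone F := monotone_nat_of_le_succ fun i => by
    rw [hFs]; linarith [hw i]
  have hw1 : ∀ i, w i ≤ 1 := fun i => by have := hF1 (i + 1); rw [hFs] at this; linarith [hF0 i]
  set l : ℕ → ℕ := fun i => ⌈- Real.logb 2 (w i)⌉₊ + 1 with hl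
  have hlog : ∀ i, 0 ≤ - Real.logb 2 (w i) := fun i => by
    have := Real.logb_nonpos one_lt_two (hw i).le (hw1 i); linarith
  have hpow : ∀ i, (2⁻¹ : ℝ) ^ l i ≤ w i / 2 := fun i => by
    have h1 : (2⁻¹ : ℝ) ^ ⌈- Real.logb 2 (w i)⌉₊ ≤ w i := by
      have h2 : - Real.logb 2 (w i) ≤ (⌈- Real.logb 2 (w i)⌉₊ : ℝ) := Nat.le_ceil _
      have h3 : (2 : ℝ) ^ (-(⌈- Real.logb 2 (w i)⌉₊ : ℝ)) ≤ w i := by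
        rw [← Real.le_logb_iff_rpow_le one_lt_two (hw i)]; linarith
      rwa [Real.rpow_neg two_pos.le, Real.rpow_natCast, ← inv_pow] at h3
    simp only [hl, pow_succ]; linarith
  -- the codeword of `i` is a dyadic interval around the midpoint of `[F i, F (i + 1))`
  have hex : ∀ i, ∃ s : List Bool, s.length = l i ∧ F i ≤ binVal s ∧
      binVal s + (2⁻¹ : ℝ) ^ l i ≤ F (i + 1) := fun i => by
    have h1 := hF1 (i + 1)
    rw [hFs] at h1
    obtain ⟨s, hs, h2, h3⟩ := exists_binVal_le (l i) (F i + w i / 2)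
      (by linarith [hF0 i, hw i]) (by linarith [hw i])
    exact ⟨s, hs, by linarith [hpow i], by rw [hFs]; linarith [hpow i]⟩
  choose C hC1 hC2 hC3 using hex
  refine ⟨C, fun i j hij => ?_, fun i => ?_⟩
  · have hp : ∀ i, (0 : ℝ) < 2⁻¹ ^ l i := fun i => by positivity
    obtain ⟨t, ht⟩ := hij
    have h1 := binVal_append (C i) t
    rw [ht, hC1] at h1
    have h2 : (2⁻¹ : ℝ) ^ l i * binVal t < 2⁻¹ ^ l i := by
      have := binVal_add_le_one t
      have h4 : (0 : ℝ) < 2⁻¹ ^ t.length := by positivity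
      nlinarith [hp i]
    have h3 : 0 ≤ (2⁻¹ : ℝ) ^ l i * binVal t := mul_nonneg (hp i).le (binVal_nonneg t)
    rcases lt_trichotomy i j with h | h | h
    · have := hmono (Nat.succ_le_of_lt h)
      have a := hC2 j; have b := hC3 i
      simp only [Nat.succ_eq_add_one] at this
      linarith
    · exact h
    · have := hmono (Nat.succ_le_of_lt h)
      have a := hC2 i; have b := hC3 j
      simp only [Nat.succ_eq_add_one] at this
      linarith [hp j]
  · rw [hC1]
    have := Nat.ceil_lt_add_one (hlog i)
    simp only [hl]; push_cast; linarith

lemma uniquelyDecodable_of_prefix_free {α : Type*} {S : Set (List α)} (hne : [] ∉ S)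
    (h : ∀ s ∈ S, ∀ t ∈ S, s <+: t → s = t) : InformationTheory.UniquelyDecodable S := by
  intro L₁
  induction L₁ with
  | nil =>
    intro L₂ _ h2 he
    cases L₂ with
    | nil => rfl
    | cons b L => simp at he; exact absurd (he.1 ▸ h2 b (by simp)) hne
  | cons a L₁ ih =>
    intro L₂ h1 h2 he
    cases L₂ with
    | nil => simp at he; exact absurd (he.1 ▸ h1 a (by simp)) hne
    | cons b L₂ =>
      simp only [List.flatten_cons] at he
      have ha : a ∈ S := h1 a (by simp)
      have hb : b ∈ S := h2 b (by simp)
      have hab : a = b := by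
        rcases List.prefix_or_prefix_of_prefix (List.prefix_append a L₁.flatten)
          (he ▸ List.prefix_append b L₂.flatten) with h' | h'
        · exact h a ha b hb h'
        · exact (h b hb a ha h').symm
      subst hab
      rw [ih L₂ (fun w hw => h1 w (by simp [hw])) (fun w hw => h2 w (by simp [hw]))
        (List.append_cancel_left he)]

/-- The Kraft inequality for a prefix-free set of binary strings, possibly infinite. -/
lemma kraft_tsum_le_one {S : Set (List Bool)} (h : ∀ s ∈ S, ∀ t ∈ S, s <+: t → s = t) :
    ∑' s, S.indicator (fun s : List Bool => (2⁻¹ : ℝ≥0∞) ^ s.length) s ≤ 1 := by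
  by_cases hne : [] ∈ S
  · have hS : S = {[]} := by
      ext t
      exact ⟨fun ht => (h [] hne t ht List.nil_prefix).symm, fun ht => ht ▸ hne⟩
    rw [hS, tsum_eq_single []]
    · simp
    · intro b hb; simp [hb]
  · rw [ENNReal.tsum_eq_iSup_sum]
    refine iSup_le fun T => ?_
    classical
    rw [Finset.sum_indicator_eq_sum_filter]
    have hk := InformationTheory.kraft_mcmillan_inequality (S := T.filter (· ∈ S))
      (uniquelyDecodable_of_prefix_free (by simp [hne]) (fun s hs t ht =>
        h s (Finset.mem_filter.1 hs).2 t (Finset.mem_filter.1 ht).2))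
    have h2 : ∀ s : List Bool, (2⁻¹ : ℝ≥0∞) ^ s.length
        = ENNReal.ofReal ((1 / Fintype.card Bool : ℝ) ^ s.length) := fun s => by
      rw [ENNReal.ofReal_pow (by positivity)]
      simp [ENNReal.ofReal_inv_of_pos]
    simp_rw [h2]
    rw [← ENNReal.ofReal_sum_of_nonneg fun j _ => by positivity]
    exact ENNReal.ofReal_le_one.2 hk

lemma tsum_div_add_sq_le_two (N : ℝ) (hN : 1 ≤ N) :
    ∑' m : ℕ, ENNReal.ofReal (N / (N + m) ^ 2) ≤ 2 := by
  refine ENNReal.tsum_le_of_sum_range_le fun n => ?_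
  rw [← ENNReal.ofReal_sum_of_nonneg fun j _ => by positivity]
  have key : ∑ m ∈ Finset.range n, N / (N + m) ^ 2 ≤ N / (N - 1 / 2) - N / (N + n - 1 / 2) := by
    induction n with
    | zero => simp
    | succ n ih =>
      rw [Finset.sum_range_succ]
      have h1 : N / (N + n) ^ 2 ≤ N / (N + n - 1 / 2) - N / (N + n + 1 / 2) := by
        have hn : (0 : ℝ) ≤ n := Nat.cast_nonneg n
        rw [div_sub_div _ _ (by linarith) (by linarith),
          div_le_div_iff₀ (by nlinarith) (by nlinarith)]
        nlinarith
      have h2 : N + ((n + 1 : ℕ) : ℝ) - 1 / 2 = N + n + 1 / 2 := by push_cast; ring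
      rw [h2]; linarith
  have h1 : N / (N - 1 / 2) ≤ 2 := by rw [div_le_iff₀ (by linarith)]; linarith
  have h2 : 0 ≤ N / (N + n - 1 / 2) := by
    have hn : (0 : ℝ) ≤ n := Nat.cast_nonneg n
    apply div_nonneg <;> linarith
  calc _ ≤ ENNReal.ofReal 2 := ENNReal.ofReal_le_ofReal (by linarith)
    _ = 2 := by simp

/-! ### Greedy rejection sampling -/

section GreedyRejection

variable {A Z : Type*} [MeasurableSpace A] [MeasurableSpace Z] (Q : Measure Z) (lev : Z → ℕ)

/-- The part of the target density `r` that greedy rejection sampling has not yet allotted before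
step `j`. Step `j` inspects a proposal from the level `(Nat.unpair j).1`, and the surviving mass,
spread uniformly over this level, is allotted as far as the target density permits. -/
def residual (r : Z → ℝ≥0∞) : ℕ → Z → ℝ≥0∞
  | 0, y => r y
  | j + 1, y => residual r j y - (if lev y = (Nat.unpair j).1 then
      (∫⁻ z, residual r j z ∂Q) / Q (lev ⁻¹' {(Nat.unpair j).1}) else 0)

/-- The probability that no proposal has been accepted before step `j`. -/
def survival (r : Z → ℝ≥0∞) (j : ℕ) : ℝ≥0∞ := ∫⁻ z, residual Q lev r j z ∂Q

/-- The density with respect to `Q` that step `j` can allot on the level it inspects. -/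
def chunk (r : Z → ℝ≥0∞) (j : ℕ) : ℝ≥0∞ := survival Q lev r j / Q (lev ⁻¹' {(Nat.unpair j).1})

/-- The same density on the whole space: it vanishes outside the level inspected at step `j`. -/
def offer (r : Z → ℝ≥0∞) (j : ℕ) (y : Z) : ℝ≥0∞ :=
  if lev y = (Nat.unpair j).1 then chunk Q lev r j else 0

/-- The density with respect to `Q` that step `j` allots. -/
def allotted (r : Z → ℝ≥0∞) (j : ℕ) (y : Z) : ℝ≥0∞ :=
  min (residual Q lev r j y) (offer Q lev r j y)

/-- The law of a proposal from the level `k`: the conditional law of `Q`. On a null level the choice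
does not matter; it only has to be a probability measure. -/
def proposal (k : ℕ) : Measure Z :=
  if Q (lev ⁻¹' {k}) = 0 then Q else Q[|lev ⁻¹' {k}]

/-- The acceptance rule of step `j` for a proposal with an independent uniform mark. -/
def Accepts (r : Z → ℝ≥0∞) (j : ℕ) (c : Z × unitInterval) : Prop :=
  lev c.1 = (Nat.unpair j).1 ∧
    ENNReal.ofReal (c.2 : ℝ) < residual Q lev r j c.1 / chunk Q lev r j

/-- The law of the common randomness: independent marked proposals, one for each step. -/
def randomness : Measure (ℕ → Z × unitInterval) :=
  Measure.infinitePi fun j => (proposal Q lev (Nat.unpair j).1).prod volume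

/-- The index of the first accepted proposal (`0` if there is none, a null event). -/
def firstAccepted (r : Z → ℝ≥0∞) (u : ℕ → Z × unitInterval) : ℕ :=
  sInf {j | Accepts Q lev r j (u j)}

variable {Q lev}

lemma residual_succ (r : Z → ℝ≥0∞) (j : ℕ) (y : Z) :
    residual Q lev r (j + 1) y = residual Q lev r j y - offer Q lev r j y := rfl

lemma residual_succ_add_allotted (r : Z → ℝ≥0∞) (j : ℕ) (y : Z) :
    residual Q lev r (j + 1) y + allotted Q lev r j y = residual Q lev r j y := by
  rw [residual_succ, allotted, tsub_add_min]

lemma residual_eq_sub_sum (r : Z → ℝ≥0∞) (j : ℕ) (y : Z) :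
    residual Q lev r j y = r y - ∑ i ∈ Finset.range j, offer Q lev r i y := by
  induction j with
  | zero => simp [residual]
  | succ j ih => rw [residual_succ, ih, Finset.sum_range_succ, tsub_add_eq_tsub_tsub]

lemma residual_le (r : Z → ℝ≥0∞) (j : ℕ) (y : Z) : residual Q lev r j y ≤ r y := by
  rw [residual_eq_sub_sum]; exact tsub_le_self

lemma sum_allotted_add_residual (r : Z → ℝ≥0∞) (j : ℕ) (y : Z) :
    ∑ i ∈ Finset.range j, allotted Q lev r i y + residual Q lev r j y = r y := by
  induction j with
  | zero => simp [residual]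
  | succ j ih =>
    rw [Finset.sum_range_succ, add_assoc, add_comm (allotted Q lev r j y),
      residual_succ_add_allotted, ih]

lemma tsum_allotted_le (r : Z → ℝ≥0∞) (y : Z) : ∑' j, allotted Q lev r j y ≤ r y :=
  ENNReal.tsum_le_of_sum_range_le fun n =>
    le_self_add.trans (sum_allotted_add_residual r n y).le

lemma survival_antitone (r : Z → ℝ≥0∞) : Antitone (survival Q lev r) :=
  antitone_nat_of_succ_le fun j => lintegral_mono fun y => by
    rw [residual_succ]; exact tsub_le_self

lemma survival_zero (r : Z → ℝ≥0∞) : survival Q lev r 0 = ∫⁻ y, r y ∂Q := rfl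

lemma measurable_residual [SFinite Q] {r : A → Z → ℝ≥0∞} (hr : Measurable (Function.uncurry r))
    (hlev : Measurable lev) (j : ℕ) :
    Measurable (fun p : A × Z => residual Q lev (r p.1) j p.2) := by
  induction j with
  | zero => exact hr
  | succ j ih =>
    simp only [residual]
    refine ih.sub (Measurable.ite ?_ ?_ measurable_const)
    · exact (hlev.comp measurable_snd) (measurableSet_singleton _)
    · exact (Measurable.lintegral_prod_right'
        (f := fun p : A × Z => residual Q lev (r p.1) j p.2) ih |>.comp measurable_fst).div_const _

lemma measurable_survival [SFinite Q] {r : A → Z → ℝ≥0∞} (hr : Measurable (Function.uncurry r))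
    (hlev : Measurable lev) (j : ℕ) : Measurable fun x => survival Q lev (r x) j :=
  Measurable.lintegral_prod_right' (f := fun p : A × Z => residual Q lev (r p.1) j p.2)
    (measurable_residual hr hlev j)

lemma measurableSet_accepts [SFinite Q] {r : A → Z → ℝ≥0∞} (hr : Measurable (Function.uncurry r))
    (hlev : Measurable lev) (j : ℕ) :
    MeasurableSet {p : A × (Z × unitInterval) | Accepts Q lev (r p.1) j p.2} := by
  simp only [Accepts, Set.ofPred_and]
  refine MeasurableSet.inter ?_ ?_
  · exact (hlev.comp (measurable_fst.comp measurable_snd)) (measurableSet_singleton _)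
  · refine measurableSet_lt ?_ ?_
    · exact (measurable_subtype_coe.comp (measurable_snd.comp measurable_snd)).ennreal_ofReal
    · refine Measurable.div ?_ ?_
      · exact (measurable_residual hr hlev j).comp
          (measurable_fst.prodMk (measurable_fst.comp measurable_snd))
      · exact ((measurable_survival hr hlev j).div_const _).comp measurable_fst

lemma measurable_firstAccepted [SFinite Q] {r : A → Z → ℝ≥0∞}
    (hr : Measurable (Function.uncurry r)) (hlev : Measurable lev) :
    Measurable fun p : A × (ℕ → Z × unitInterval) => firstAccepted Q lev (r p.1) p.2 := by
  have hS : ∀ j, MeasurableSet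
      {p : A × (ℕ → Z × unitInterval) | Accepts Q lev (r p.1) j (p.2 j)} := fun j =>
    (measurable_fst.prodMk ((measurable_pi_apply j).comp measurable_snd) :
      Measurable fun p : A × (ℕ → Z × unitInterval) => (p.1, p.2 j))
      (measurableSet_accepts hr hlev j)
  refine measurable_to_nat fun q => ?_
  set k := firstAccepted Q lev (r q.1) q.2
  have : (fun p : A × (ℕ → Z × unitInterval) => firstAccepted Q lev (r p.1) p.2) ⁻¹' {k}
      = {p | (Accepts Q lev (r p.1) k (p.2 k) ∧ ∀ i, i < k → ¬ Accepts Q lev (r p.1) i (p.2 i)) ∨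
          (k = 0 ∧ ∀ i, ¬ Accepts Q lev (r p.1) i (p.2 i))} := by
    ext p
    simp only [Set.mem_preimage, Set.mem_singleton_iff, Set.mem_ofPred_eq, firstAccepted]
    by_cases hne : {j | Accepts Q lev (r p.1) j (p.2 j)}.Nonempty
    · constructor
      · intro h
        left
        exact ⟨h ▸ Nat.sInf_mem hne, fun i hi hi' => Nat.notMem_of_lt_sInf (h ▸ hi) hi'⟩
      · rintro (⟨h1, h2⟩ | ⟨_, h2⟩)
        · refine le_antisymm (Nat.sInf_le h1) ?_
          by_contra hlt
          exact h2 _ (not_le.1 hlt) (Nat.sInf_mem hne)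
        · obtain ⟨i, hi⟩ := hne
          exact absurd hi (h2 i)
    · have hemp := Set.not_nonempty_iff_eq_empty.1 hne
      have hno : ∀ i, ¬ Accepts Q lev (r p.1) i (p.2 i) := fun i hi => hne ⟨i, hi⟩
      rw [hemp, Nat.sInf_empty]
      constructor
      · intro h; exact Or.inr ⟨h.symm, hno⟩
      · rintro (⟨h1, _⟩ | ⟨h1, _⟩)
        · exact absurd h1 (hno _)
        · exact h1.symm
  rw [this]
  simp only [Set.ofPred_or, Set.ofPred_and, Set.ofPred_forall]
  refine MeasurableSet.union (MeasurableSet.inter (hS k) ?_) (MeasurableSet.inter (by simp) ?_)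
  · exact MeasurableSet.iInter fun i => MeasurableSet.iInter fun _ => (hS i).compl
  · exact MeasurableSet.iInter fun i => (hS i).compl

instance [IsProbabilityMeasure Q] (k : ℕ) : IsProbabilityMeasure (proposal Q lev k) := by
  unfold proposal
  split_ifs with h
  · infer_instance
  · exact cond_isProbabilityMeasure h

instance [IsProbabilityMeasure Q] : IsProbabilityMeasure (randomness Q lev) := by
  unfold randomness; infer_instance

section FixedTarget

variable {r : Z → ℝ≥0∞}

lemma measurable_residual_right [SFinite Q] (hr : Measurable r) (hlev : Measurable lev) (j : ℕ) :
    Measurable (residual Q lev r j) :=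
  (measurable_residual (A := Unit) (r := fun _ => r) (hr.comp measurable_snd) hlev j).comp
    (measurable_const (a := ()) |>.prodMk measurable_id)

lemma measurableSet_accepts_right [SFinite Q] (hr : Measurable r) (hlev : Measurable lev) (j : ℕ) :
    MeasurableSet {c | Accepts Q lev r j c} :=
  (measurable_const (a := ()) |>.prodMk measurable_id)
    (measurableSet_accepts (A := Unit) (r := fun _ => r) (hr.comp measurable_snd) hlev j)

lemma measurable_allotted [SFinite Q] (hr : Measurable r) (hlev : Measurable lev) (j : ℕ) :
    Measurable (allotted Q lev r j) :=
  (measurable_residual_right hr hlev j).min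
    (Measurable.ite (hlev (measurableSet_singleton _)) measurable_const measurable_const)

lemma survival_le_one (h1 : ∫⁻ y, r y ∂Q = 1) (j : ℕ) : survival Q lev r j ≤ 1 :=
  (survival_antitone r (Nat.zero_le j)).trans (by rw [survival_zero, h1])

lemma survival_succ_add [SFinite Q] (hr : Measurable r) (hlev : Measurable lev) (j : ℕ) :
    survival Q lev r (j + 1) + ∫⁻ y, allotted Q lev r j y ∂Q = survival Q lev r j := by
  rw [survival, ← lintegral_add_right _ (measurable_allotted hr hlev j)]
  simp_rw [residual_succ_add_allotted]
  rfl

lemma volume_ofReal_lt (b : ℝ≥0∞) :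
    volume {t : unitInterval | ENNReal.ofReal (t : ℝ) < b} = min 1 b := by
  rcases le_or_gt 1 b with h | h
  · rw [min_eq_left h]
    rcases h.eq_or_lt with rfl | h
    · have : {t : unitInterval | ENNReal.ofReal (t : ℝ) < 1} = Set.Iio 1 := by
        ext t
        simp only [Set.mem_ofPred_eq, ENNReal.ofReal_lt_one, Set.mem_Iio]
        exact Iff.rfl
      rw [this, unitInterval.volume_Iio]
      simp
    · have : {t : unitInterval | ENNReal.ofReal (t : ℝ) < b} = Set.univ := by
        ext t
        simp only [Set.mem_ofPred_eq, Set.mem_univ, iff_true]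
        exact (ENNReal.ofReal_le_one.2 t.2.2).trans_lt h
      rw [this, measure_univ]
  · rw [min_eq_right h.le]
    have hb : b ≠ ⊤ := (h.trans ENNReal.one_lt_top).ne
    have hb1 : b.toReal ≤ 1 := ENNReal.toReal_le_of_le_ofReal zero_le_one (by simpa using h.le)
    have : {t : unitInterval | ENNReal.ofReal (t : ℝ) < b}
        = Set.Iio (⟨b.toReal, ENNReal.toReal_nonneg, hb1⟩ : unitInterval) := by
      ext t
      simp only [Set.mem_ofPred_eq, Set.mem_Iio]
      rw [ENNReal.ofReal_lt_iff_lt_toReal t.2.1 hb]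
      exact Iff.rfl
    rw [this, unitInterval.volume_Iio]
    exact ENNReal.ofReal_toReal hb

lemma survival_mul_accepts [IsProbabilityMeasure Q] (hr : Measurable r) (hlev : Measurable lev)
    (h1 : ∫⁻ y, r y ∂Q = 1) (j : ℕ) {B : Set Z} (hB : MeasurableSet B) :
    survival Q lev r j * (proposal Q lev (Nat.unpair j).1).prod volume
      {c | Accepts Q lev r j c ∧ c.1 ∈ B} = ∫⁻ y in B, allotted Q lev r j y ∂Q := by
  set k := (Nat.unpair j).1 with hk
  set p := Q (lev ⁻¹' {k}) with hp
  set s := survival Q lev r j with hs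
  have hL : MeasurableSet (lev ⁻¹' {k}) := hlev (measurableSet_singleton _)
  have hS : MeasurableSet {c | Accepts Q lev r j c ∧ c.1 ∈ B} :=
    (measurableSet_accepts_right hr hlev j).inter (measurable_fst hB)
  have hchunk : chunk Q lev r j = s / p := rfl
  have hsec : ∀ y, (volume : Measure unitInterval)
      (Prod.mk y ⁻¹' {c | Accepts Q lev r j c ∧ c.1 ∈ B})
      = (lev ⁻¹' {k}).indicator
          (B.indicator fun y => min 1 (residual Q lev r j y / (s / p))) y := fun y => by
    by_cases h1 : lev y = k
    · by_cases h2 : y ∈ B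
      · rw [Set.indicator_of_mem (by exact h1), Set.indicator_of_mem h2, ← volume_ofReal_lt]
        congr 1
        ext t
        simp [Accepts, h1, h2, hchunk, ← hk]
      · rw [Set.indicator_of_mem (by exact h1), Set.indicator_of_notMem h2]
        simp [h2]
    · rw [Set.indicator_of_notMem (by exact h1)]
      simp [Accepts, h1, ← hk]
  rcases eq_or_ne s 0 with h0 | h0
  · rw [h0, zero_mul]
    have : ∀ y, allotted Q lev r j y = 0 := fun y => by
      simp [allotted, offer, hchunk, h0]
    simp [this]
  have hs1 : s ≤ 1 := survival_le_one h1 j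
  rw [Measure.prod_apply hS]
  simp_rw [hsec]
  rw [lintegral_indicator hL, ← lintegral_indicator hB]
  rcases eq_or_ne p 0 with hp0 | hp0
  · have h2 : Q.restrict (lev ⁻¹' {k}) = 0 := Measure.restrict_eq_zero.2 hp0
    have h3 : ∀ᵐ y ∂Q, lev y ≠ k := by
      rw [ae_iff]
      simp only [not_not]
      exact hp0
    rw [proposal, if_pos hp0, h2, lintegral_zero_measure, mul_zero]
    symm
    rw [lintegral_eq_zero_iff' ((measurable_allotted hr hlev j).indicator hB).aemeasurable]
    filter_upwards [h3] with y hy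
    simp only [Set.indicator, Pi.zero_apply]
    split_ifs with h
    · simp [allotted, offer, ← hk, hy]
    · rfl
  · have hc0 : s / p ≠ 0 := (ENNReal.div_pos h0 (measure_ne_top _ _)).ne'
    have hct : s / p ≠ ⊤ := ENNReal.div_ne_top (hs1.trans_lt ENNReal.one_lt_top).ne hp0
    rw [proposal, if_neg hp0, ProbabilityTheory.cond, Measure.restrict_smul,
      Measure.restrict_restrict hL, Set.inter_self, lintegral_smul_measure, smul_eq_mul,
      ← mul_assoc, ← div_eq_mul_inv, ← lintegral_indicator hL, ← lintegral_const_mul' _ _ hct]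
    refine lintegral_congr fun y => ?_
    by_cases h1 : lev y = k
    · by_cases h2 : y ∈ B
      · rw [Set.indicator_of_mem (by exact h1), Set.indicator_of_mem h2, Set.indicator_of_mem h2]
        simp only [allotted, offer, ← hk, h1, if_true, hchunk]
        rw [mul_min, mul_one, ENNReal.mul_div_cancel hc0 hct, min_comm]
      · rw [Set.indicator_of_mem (by exact h1), Set.indicator_of_notMem h2,
          Set.indicator_of_notMem h2, mul_zero]
    · rw [Set.indicator_of_notMem (by exact h1), mul_zero]
      simp only [Set.indicator]
      split_ifs
      · simp [allotted, offer, ← hk, h1]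
      · rfl

lemma survival_mul_rejects [IsProbabilityMeasure Q] (hr : Measurable r) (hlev : Measurable lev)
    (h1 : ∫⁻ y, r y ∂Q = 1) (j : ℕ) :
    survival Q lev r j * (proposal Q lev (Nat.unpair j).1).prod volume
      {c | ¬ Accepts Q lev r j c} = survival Q lev r (j + 1) := by
  have h := survival_mul_accepts hr hlev h1 j MeasurableSet.univ
  simp only [Set.mem_univ, and_true, Measure.restrict_univ] at h
  have h2 := survival_succ_add (Q := Q) hr hlev j
  have h3 := prob_add_prob_compl (μ := (proposal Q lev (Nat.unpair j).1).prod
    (volume : Measure unitInterval)) (measurableSet_accepts_right hr hlev j (Q := Q))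
  have h4 : survival Q lev r j ≠ ⊤ := ((survival_le_one h1 j).trans_lt ENNReal.one_lt_top).ne
  rw [← h] at h2
  have h5 : survival Q lev r j * (proposal Q lev (Nat.unpair j).1).prod volume
      {c | Accepts Q lev r j c} ≠ ⊤ := ENNReal.mul_ne_top h4 (measure_ne_top _ _)
  refine (ENNReal.add_left_inj h5).1 ?_
  rw [h2, add_comm, ← mul_add]
  change _ * (_ + (proposal Q lev (Nat.unpair j).1).prod volume {c | Accepts Q lev r j c}ᶜ) = _
  rw [h3, mul_one]

lemma prod_rejects [IsProbabilityMeasure Q] (hr : Measurable r) (hlev : Measurable lev)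
    (h1 : ∫⁻ y, r y ∂Q = 1) (j : ℕ) :
    ∏ i ∈ Finset.range j, (proposal Q lev (Nat.unpair i).1).prod volume
      {c | ¬ Accepts Q lev r i c} = survival Q lev r j := by
  induction j with
  | zero => rw [survival_zero, h1]; simp
  | succ j ih => rw [Finset.prod_range_succ, ih, survival_mul_rejects hr hlev h1]

/-- The event that the first accepted proposal is that of step `j`. -/
def acceptedAt (Q : Measure Z) (lev : Z → ℕ) (r : Z → ℝ≥0∞) (j : ℕ) :
    Set (ℕ → Z × unitInterval) :=
  {u | Accepts Q lev r j (u j) ∧ ∀ i < j, ¬ Accepts Q lev r i (u i)}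

lemma firstAccepted_eq {j : ℕ} {u : ℕ → Z × unitInterval} (hu : u ∈ acceptedAt Q lev r j) :
    firstAccepted Q lev r u = j := by
  refine le_antisymm (Nat.sInf_le hu.1) ?_
  by_contra h
  exact hu.2 _ (not_le.1 h) (Nat.sInf_mem (s := {j | Accepts Q lev r j (u j)}) ⟨j, hu.1⟩)

lemma measurableSet_acceptedAt [SFinite Q] (hr : Measurable r) (hlev : Measurable lev) (j : ℕ) :
    MeasurableSet (acceptedAt Q lev r j) := by
  simp only [acceptedAt, Set.ofPred_and, Set.ofPred_forall]
  have hS : ∀ i, MeasurableSet {u : ℕ → Z × unitInterval | Accepts Q lev r i (u i)} := fun i =>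
    (measurable_pi_apply i : Measurable fun u : ℕ → Z × unitInterval => u i)
      (measurableSet_accepts_right hr hlev i)
  exact (hS j).inter (MeasurableSet.iInter fun i => MeasurableSet.iInter fun _ => (hS i).compl)

lemma randomness_acceptedAt [IsProbabilityMeasure Q] (hr : Measurable r) (hlev : Measurable lev)
    (h1 : ∫⁻ y, r y ∂Q = 1) (j : ℕ) {B : Set Z} (hB : MeasurableSet B) :
    randomness Q lev (acceptedAt Q lev r j ∩ {u | (u j).1 ∈ B})
      = ∫⁻ y in B, allotted Q lev r j y ∂Q := by
  classical
  have hset : acceptedAt Q lev r j ∩ {u | (u j).1 ∈ B}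
      = Set.pi (Finset.range (j + 1)) (fun i => if i = j then
        {c | Accepts Q lev r j c ∧ c.1 ∈ B} else {c | ¬ Accepts Q lev r i c}) := by
    ext u
    simp only [acceptedAt, Set.mem_inter_iff, Set.mem_ofPred_eq, Set.mem_pi, Finset.coe_range,
      Set.mem_Iio]
    constructor
    · rintro ⟨⟨h1, h2⟩, h3⟩ i hi
      split_ifs with h
      · subst h; exact ⟨h1, h3⟩
      · exact h2 i (by omega)
    · intro h
      have hj := h j (by omega)
      rw [if_pos rfl] at hj
      refine ⟨⟨hj.1, fun i hi => ?_⟩, hj.2⟩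
      have := h i (by omega)
      rwa [if_neg (by omega)] at this
  rw [hset, randomness, Measure.infinitePi_pi, Finset.prod_range_succ, if_pos rfl,
    ← survival_mul_accepts hr hlev h1 j hB, ← prod_rejects hr hlev h1 j]
  · congr 1
    refine Finset.prod_congr rfl fun i hi => ?_
    rw [if_neg (Finset.mem_range.1 hi).ne]
  · intro i _
    split_ifs with h
    · subst h
      exact (measurableSet_accepts_right hr hlev i).inter (measurable_fst hB)
    · exact (measurableSet_accepts_right hr hlev i).compl

/-- Every level is inspected infinitely often, so that mass which survives for ever would exhaust
the target density. -/
lemma tendsto_survival [IsProbabilityMeasure Q] (hr : Measurable r) (hlev : Measurable lev)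
    (hfin : ∀ y, r y ≠ ⊤) (h1 : ∫⁻ y, r y ∂Q = 1) :
    Tendsto (survival Q lev r) atTop (𝓝 0) := by
  have hlim := tendsto_atTop_iInf (survival_antitone (Q := Q) (lev := lev) r)
  set ε := ⨅ j, survival Q lev r j with hε
  rcases eq_or_ne ε 0 with h0 | h0
  · rwa [h0] at hlim
  have hpt : ∀ y, Tendsto (fun j => residual Q lev r j y) atTop (𝓝 0) := fun y => by
    have hsum : ∑' i, offer Q lev r i y = ⊤ := by
      refine top_le_iff.1 ?_
      have hle : ∑' i, (if (Nat.unpair i).1 = lev y then ε else 0) ≤ ∑' i, offer Q lev r i y := by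
        refine ENNReal.tsum_le_tsum fun i => ?_
        unfold offer
        by_cases h : lev y = (Nat.unpair i).1
        · rw [if_pos h, if_pos h.symm]
          calc ε ≤ survival Q lev r i := iInf_le _ _
            _ = survival Q lev r i / 1 := (div_one _).symm
            _ ≤ _ := ENNReal.div_le_div_left prob_le_one _
        · rw [if_neg (fun h' => h h'.symm)]; exact zero_le
      refine le_trans ?_ hle
      rw [← Nat.pairEquiv.tsum_eq]
      simp only [Nat.pairEquiv_apply, Function.uncurry_def, Nat.unpair_pair]
      rw [ENNReal.tsum_prod', tsum_eq_single (lev y)]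
      · simp [ENNReal.tsum_const_eq_top_of_ne_zero h0]
      · intro k hk; simp [hk]
    have h2 := ENNReal.tendsto_nat_tsum (fun i => offer Q lev r i y)
    rw [hsum] at h2
    have h3 := ENNReal.Tendsto.sub (tendsto_const_nhds (x := r y)) h2 (Or.inl (hfin y))
    simp only [ENNReal.sub_top] at h3
    simp_rw [residual_eq_sub_sum]
    exact h3
  have h3 := tendsto_lintegral_of_dominated_convergence (μ := Q) (F := residual Q lev r)
    (f := fun _ => 0) r (measurable_residual_right hr hlev)
    (fun j => ae_of_all _ (residual_le r j)) (by rw [h1]; simp) (ae_of_all _ hpt)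
  rwa [lintegral_zero] at h3

lemma tsum_allotted [IsProbabilityMeasure Q] (hr : Measurable r) (hlev : Measurable lev)
    (hfin : ∀ y, r y ≠ ⊤) (h1 : ∫⁻ y, r y ∂Q = 1) :
    ∑' j, ∫⁻ y, allotted Q lev r j y ∂Q = 1 := by
  have hpart : ∀ n, ∑ j ∈ Finset.range n, ∫⁻ y, allotted Q lev r j y ∂Q + survival Q lev r n = 1 :=
    fun n => by
      rw [← lintegral_finsetSum _ fun j _ => measurable_allotted hr hlev j, survival,
        ← lintegral_add_right _ (measurable_residual_right hr hlev n)]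
      simp_rw [sum_allotted_add_residual, h1]
  have h2 := (ENNReal.tendsto_nat_tsum (fun j => ∫⁻ y, allotted Q lev r j y ∂Q)).add
    (tendsto_survival (Q := Q) hr hlev hfin h1)
  simp_rw [hpart, add_zero] at h2
  exact tendsto_nhds_unique h2 tendsto_const_nhds

lemma tsum_allotted_ae_eq [IsProbabilityMeasure Q] (hr : Measurable r) (hlev : Measurable lev)
    (hfin : ∀ y, r y ≠ ⊤) (h1 : ∫⁻ y, r y ∂Q = 1) :
    (fun y => ∑' j, allotted Q lev r j y) =ᵐ[Q] r := by
  have h2 : ∫⁻ y, ∑' j, allotted Q lev r j y ∂Q = 1 := by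
    rw [lintegral_tsum fun j => (measurable_allotted hr hlev j).aemeasurable,
      tsum_allotted hr hlev hfin h1]
  exact ae_eq_of_ae_le_of_lintegral_le (ae_of_all _ (tsum_allotted_le r)) (by rw [h2]; simp)
    hr.aemeasurable (by rw [h1, h2])

/-- The joint law of the index and of the value of the first accepted proposal. -/
lemma lintegral_firstAccepted [IsProbabilityMeasure Q] (hr : Measurable r) (hlev : Measurable lev)
    (hfin : ∀ y, r y ≠ ⊤) (h1 : ∫⁻ y, r y ∂Q = 1) (g : ℕ → Z → ℝ≥0∞) (hg : ∀ j, Measurable (g j)) :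
    ∫⁻ u, g (firstAccepted Q lev r u) (u (firstAccepted Q lev r u)).1 ∂(randomness Q lev)
      = ∑' j, ∫⁻ y, allotted Q lev r j y * g j y ∂Q := by
  have hm := measurableSet_acceptedAt (Q := Q) hr hlev
  have hdisj : Pairwise (Function.onFun Disjoint (acceptedAt Q lev r)) := fun i j hij =>
    Set.disjoint_left.2 fun u hi hj => hij ((firstAccepted_eq hi).symm.trans (firstAccepted_eq hj))
  have hfull : ∀ᵐ u ∂(randomness Q lev), u ∈ ⋃ j, acceptedAt Q lev r j := by
    rw [Filter.Eventually, Set.ofPred_mem_eq, mem_ae_iff_prob_eq_one (MeasurableSet.iUnion hm), measure_iUnion hdisj hm,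
      ← tsum_allotted hr hlev hfin h1 (Q := Q)]
    refine tsum_congr fun j => ?_
    have := randomness_acceptedAt (Q := Q) hr hlev h1 j MeasurableSet.univ
    simpa using this
  rw [← Measure.restrict_eq_self_of_ae_mem hfull, lintegral_iUnion hm hdisj]
  refine tsum_congr fun j => ?_
  have hev : Measurable fun u : ℕ → Z × unitInterval => (u j).1 :=
    measurable_fst.comp (measurable_pi_apply j)
  have hlaw : Measure.map (fun u : ℕ → Z × unitInterval => (u j).1)
      ((randomness Q lev).restrict (acceptedAt Q lev r j))
      = Q.withDensity (allotted Q lev r j) := by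
    ext B hB
    rw [Measure.map_apply hev hB, Measure.restrict_apply (hev hB), withDensity_apply _ hB,
      ← randomness_acceptedAt hr hlev h1 j hB, Set.inter_comm]
    rfl
  calc _ = ∫⁻ u in acceptedAt Q lev r j, g j (u j).1 ∂(randomness Q lev) := by
        refine setLIntegral_congr_fun (hm j) fun u hu => ?_
        simp only [firstAccepted_eq hu]
    _ = ∫⁻ y, g j y ∂(Q.withDensity (allotted Q lev r j)) := by
        rw [← hlaw, lintegral_map (hg j) hev]
    _ = _ := by
        rw [lintegral_withDensity_eq_lintegral_mul _ (measurable_allotted hr hlev j) (hg j)]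
        rfl

/-- The first accepted proposal has the target law. -/
lemma lintegral_accepted_value [IsProbabilityMeasure Q] (hr : Measurable r) (hlev : Measurable lev)
    (hfin : ∀ y, r y ≠ ⊤) (h1 : ∫⁻ y, r y ∂Q = 1) {g : Z → ℝ≥0∞} (hg : Measurable g) :
    ∫⁻ u, g (u (firstAccepted Q lev r u)).1 ∂(randomness Q lev) = ∫⁻ y, r y * g y ∂Q := by
  rw [lintegral_firstAccepted hr hlev hfin h1 (fun _ => g) (fun _ => hg),
    ← lintegral_tsum (f := fun j y => allotted Q lev r j y * g y)
      fun j => ((measurable_allotted hr hlev j).mul hg).aemeasurable]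
  refine lintegral_congr_ae ?_
  filter_upwards [tsum_allotted_ae_eq (Q := Q) hr hlev hfin h1] with y hy
  rw [ENNReal.tsum_mul_right, hy]

/-- If step `j` allots mass to `y`, then the position of step `j` within its level, times the
surviving mass, is at most the target density relative to the law of the level: the earlier steps
at the level have each offered at least as much. -/
lemma survival_mul_le (hfin : ∀ y, r y ≠ ⊤) {j : ℕ} {y : Z} (h : allotted Q lev r j y ≠ 0)
    [IsProbabilityMeasure Q] :
    lev y = (Nat.unpair j).1 ∧ survival Q lev r j ≠ 0 ∧
      survival Q lev r j * (Nat.unpair j).2 ≤ r y * Q (lev ⁻¹' {lev y}) := by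
  have hres : residual Q lev r j y ≠ 0 := fun h0 => h (by simp [allotted, h0])
  have hoff : offer Q lev r j y ≠ 0 := fun h0 => h (by simp [allotted, h0])
  have hl : lev y = (Nat.unpair j).1 := by
    by_contra hl; exact hoff (by simp [offer, hl])
  refine ⟨hl, fun h0 => hoff (by simp [offer, chunk, h0]), ?_⟩
  rw [residual_eq_sub_sum, Ne, tsub_eq_zero_iff_le, not_le] at hres
  have hpair : Nat.pair (lev y) (Nat.unpair j).2 = j := by rw [hl, Nat.pair_unpair]
  set m := (Nat.unpair j).2
  have hsub : (Finset.range m).image (Nat.pair (lev y)) ⊆ Finset.range j := by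
    intro i hi
    obtain ⟨m', hm', rfl⟩ := Finset.mem_image.1 hi
    rw [Finset.mem_range]
    conv_rhs => rw [← hpair]
    exact Nat.pair_lt_pair_right _ (Finset.mem_range.1 hm')
  have hsum : (m : ℝ≥0∞) * (survival Q lev r j / Q (lev ⁻¹' {lev y})) ≤ r y := by
    refine le_trans ?_ hres.le
    refine le_trans ?_ (Finset.sum_le_sum_of_subset hsub)
    rw [Finset.sum_image fun a _ b _ hab => (Nat.pair_eq_pair.1 hab).2]
    calc _ = ∑ _i ∈ Finset.range m, survival Q lev r j / Q (lev ⁻¹' {lev y}) := by simp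
      _ ≤ _ := by
        refine Finset.sum_le_sum fun i hi => ?_
        simp only [offer, chunk, Nat.unpair_pair, if_true]
        refine ENNReal.div_le_div_right (survival_antitone r ?_) _
        have := hsub (Finset.mem_image_of_mem _ hi)
        exact (Finset.mem_range.1 this).le
  rw [← mul_div_assoc, ENNReal.div_le_iff_le_mul (Or.inr (hfin y))
    (Or.inl (measure_ne_top _ _))] at hsum
  rwa [mul_comm] at hsum

lemma tsum_allotted_div_sqrt_le [IsProbabilityMeasure Q] (hr : Measurable r)
    (hlev : Measurable lev) (h1 : ∫⁻ y, r y ∂Q = 1) :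
    ∑' j, (∫⁻ y, allotted Q lev r j y ∂Q) * ENNReal.ofReal (1 / √(survival Q lev r j).toReal)
      ≤ 2 := by
  refine ENNReal.tsum_le_of_sum_range_le fun n => ?_
  set σ : ℕ → ℝ := fun j => (survival Q lev r j).toReal with hσ
  have hst : ∀ j, survival Q lev r j ≠ ⊤ := fun j =>
    ((survival_le_one h1 j).trans_lt ENNReal.one_lt_top).ne
  have key : ∀ n, ∑ j ∈ Finset.range n, (∫⁻ y, allotted Q lev r j y ∂Q) *
      ENNReal.ofReal (1 / √(σ j)) + ENNReal.ofReal (2 * √(σ n)) ≤ 2 := fun n => by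
    induction n with
    | zero => simp [hσ, survival_zero, h1]
    | succ n ih =>
      refine le_trans ?_ ih
      rw [Finset.sum_range_succ, add_assoc]
      gcongr
      have hd := survival_succ_add (Q := Q) hr hlev n
      set d := ∫⁻ y, allotted Q lev r n y ∂Q
      have hdt : d ≠ ⊤ := fun h => hst n (by rw [← hd, h, add_top])
      have hd' : σ (n + 1) + d.toReal = σ n := by
        simp only [hσ]; rw [← ENNReal.toReal_add (hst _) hdt, hd]
      have ha : 0 ≤ σ (n + 1) := ENNReal.toReal_nonneg
      have hdn : 0 ≤ d.toReal := ENNReal.toReal_nonneg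
      rw [← ENNReal.ofReal_toReal hdt, ← ENNReal.ofReal_mul hdn,
        ← ENNReal.ofReal_add (by positivity) (by positivity)]
      apply ENNReal.ofReal_le_ofReal
      rcases eq_or_lt_of_le (show 0 ≤ σ n by linarith) with h0 | h0
      · have h2 : σ (n + 1) = 0 := by linarith
        rw [← h0, h2]; simp
      · have h2 : 0 < √(σ n) := Real.sqrt_pos.2 h0
        have h3 : √(σ (n + 1)) ≤ √(σ n) := Real.sqrt_le_sqrt (by linarith)
        have h4 := Real.sq_sqrt h0.le
        have h5 := Real.sq_sqrt ha
        have h6 := Real.sqrt_nonneg (σ (n + 1))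
        have h7 : d.toReal * (1 / √(σ n)) ≤ 2 * (√(σ n) - √(σ (n + 1))) := by
          rw [mul_one_div, div_le_iff₀ h2]
          nlinarith
        linarith
  exact le_self_add.trans (key n)

/-- The cost of a code for the index of the first accepted proposal. -/
lemma lintegral_length_firstAccepted_le [IsProbabilityMeasure Q] (hr : Measurable r)
    (hlev : Measurable lev) (hfin : ∀ y, r y ≠ ⊤) (h1 : ∫⁻ y, r y ∂Q = 1) (C : ℕ → List Bool)
    {a : Z → ℝ≥0∞} (ha : Measurable a) {b : ℝ} (hb : 0 ≤ b)
    (hC : ∀ y (m : ℕ) (s : ℝ), 0 < s → s ≤ 1 → ENNReal.ofReal s * m ≤ r y * Q (lev ⁻¹' {lev y}) →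
      ((C (Nat.pair (lev y) m)).length : ℝ≥0∞) ≤ a y + ENNReal.ofReal (b / √s)) :
    ∫⁻ u, ((C (firstAccepted Q lev r u)).length : ℝ≥0∞) ∂(randomness Q lev)
      ≤ ∫⁻ y, r y * a y ∂Q + ENNReal.ofReal (2 * b) := by
  rw [lintegral_firstAccepted hr hlev hfin h1 (fun j _ => ((C j).length : ℝ≥0∞))
    (fun _ => measurable_const)]
  calc _ ≤ ∑' j, (∫⁻ y, allotted Q lev r j y * a y ∂Q +
        ENNReal.ofReal b * ((∫⁻ y, allotted Q lev r j y ∂Q) *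
          ENNReal.ofReal (1 / √(survival Q lev r j).toReal))) := by
        refine ENNReal.tsum_le_tsum fun j => ?_
        rw [mul_left_comm, ← ENNReal.ofReal_mul hb, mul_one_div,
          ← lintegral_mul_const _ (measurable_allotted hr hlev j),
          ← lintegral_add_left (f := fun y => allotted Q lev r j y * a y)
            ((measurable_allotted hr hlev j).mul ha)]
        refine lintegral_mono fun y => ?_
        rw [← mul_add]
        rcases eq_or_ne (allotted Q lev r j y) 0 with h0 | h0
        · rw [h0, zero_mul]; exact zero_le
        · obtain ⟨hl, hs, hm⟩ := survival_mul_le hfin h0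
          have hst : survival Q lev r j ≠ ⊤ :=
            ((survival_le_one h1 j).trans_lt ENNReal.one_lt_top).ne
          have := hC y (Nat.unpair j).2 (survival Q lev r j).toReal
            (ENNReal.toReal_pos hs hst)
            (ENNReal.toReal_le_of_le_ofReal zero_le_one (by simpa using survival_le_one h1 j))
            (by rwa [ENNReal.ofReal_toReal hst])
          rw [hl, Nat.pair_unpair] at this
          gcongr
    _ = ∑' j, ∫⁻ y, allotted Q lev r j y * a y ∂Q + ENNReal.ofReal b *
          ∑' j, ((∫⁻ y, allotted Q lev r j y ∂Q) *
          ENNReal.ofReal (1 / √(survival Q lev r j).toReal)) := by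
        rw [ENNReal.tsum_add, ENNReal.tsum_mul_left]
    _ ≤ _ := by
        gcongr
        · rw [← lintegral_tsum (f := fun j y => allotted Q lev r j y * a y)
            fun j => ((measurable_allotted hr hlev j).mul ha).aemeasurable]
          refine lintegral_mono fun y => ?_
          rw [ENNReal.tsum_mul_right]
          exact mul_le_mul_left (tsum_allotted_le r y) _
        · calc _ ≤ ENNReal.ofReal b * 2 := by
                gcongr; exact tsum_allotted_div_sqrt_le hr hlev h1
            _ = _ := by rw [mul_comm 2 b, ENNReal.ofReal_mul hb]; simp

end FixedTarget

end GreedyRejection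

/-! ### Product laws and joint densities -/

section Products

variable {ι : Type*} [Fintype ι]

lemma lintegral_pi_prod {Ω : ι → Type*} [∀ i, MeasurableSpace (Ω i)]
    {ν : ∀ i, Measure (Ω i)} [∀ i, IsProbabilityMeasure (ν i)] {f : ∀ i, Ω i → ℝ≥0∞}
    (hf : ∀ i, Measurable (f i)) :
    ∫⁻ ω, ∏ i, f i (ω i) ∂(Measure.pi ν) = ∏ i, ∫⁻ x, f i x ∂(ν i) := by
  refine (lintegral_prod_eq_prod_lintegral_of_indepFun Finset.univ (fun i (ω : ∀ i, Ω i) => f i (ω i))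
    (iIndepFun_pi fun i => (hf i).aemeasurable)
    (fun i => (hf i).comp (measurable_pi_apply i))).trans ?_
  exact Finset.prod_congr rfl fun i _ => (measurePreserving_eval ν i).lintegral_comp (hf i)

lemma pi_withDensity {Ω : Type*} [MeasurableSpace Ω] (ν : Measure Ω) [IsProbabilityMeasure ν]
    {f : Ω → ℝ≥0∞} (hf : Measurable f) [SigmaFinite (ν.withDensity f)] :
    Measure.pi (fun _ : ι => ν.withDensity f)
      = (Measure.pi fun _ : ι => ν).withDensity (fun ω => ∏ i, f (ω i)) := by
  refine Measure.pi_eq fun s hs => ?_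
  rw [withDensity_apply _ (MeasurableSet.univ_pi hs),
    ← lintegral_indicator (MeasurableSet.univ_pi hs)]
  have : ∀ ω : ι → Ω, (Set.univ.pi s).indicator (fun ω => ∏ i, f (ω i)) ω
      = ∏ i, (s i).indicator f (ω i) := fun ω => by
    by_cases h : ω ∈ Set.univ.pi s
    · rw [Set.indicator_of_mem h]
      exact Finset.prod_congr rfl fun i _ => (Set.indicator_of_mem (h i trivial) f).symm
    · rw [Set.indicator_of_notMem h]
      simp only [Set.mem_pi, Set.mem_univ, true_imp_iff, not_forall] at h
      obtain ⟨i, hi⟩ := h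
      exact (Finset.prod_eq_zero (Finset.mem_univ i) (Set.indicator_of_notMem hi f)).symm
  simp_rw [this]
  rw [lintegral_pi_prod fun i => hf.indicator (hs i)]
  refine Finset.prod_congr rfl fun i _ => ?_
  rw [lintegral_indicator (hs i), withDensity_apply _ (hs i)]

end Products

section Density

variable {X Y : Type*} [MeasurableSpace X] [MeasurableSpace Y]

/-- `r` is a density of the joint law of the source `μ` and the channel `κ` with respect to the
product of its marginals, in a finite version whose sections at all `x` are probability
densities. -/
structure IsJointDensity (μ : Measure X) (κ : Kernel X Y) (r : X → Y → ℝ≥0∞) : Prop where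
  measurable : Measurable (Function.uncurry r)
  ne_top : ∀ x y, r x y ≠ ⊤
  lintegral_eq_one : ∀ x, ∫⁻ y, r x y ∂(κ ∘ₘ μ) = 1
  withDensity_eq : (μ.prod (κ ∘ₘ μ)).withDensity (Function.uncurry r) = μ ⊗ₘ κ

variable {μ : Measure X} {κ : Kernel X Y}

namespace IsJointDensity

variable {r : X → Y → ℝ≥0∞}

lemma measurable_section (hr : IsJointDensity μ κ r) (x : X) : Measurable (r x) :=
  hr.measurable.comp measurable_prodMk_left

lemma ae_ne_zero (hr : IsJointDensity μ κ r) : ∀ᵐ p ∂(μ ⊗ₘ κ), r p.1 p.2 ≠ 0 := by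
  rw [← hr.withDensity_eq, ae_withDensity_iff hr.measurable]
  exact ae_of_all _ fun p hp => hp

end IsJointDensity

variable [IsProbabilityMeasure μ] [IsMarkovKernel κ]

/-- The information density is the logarithm of a suitable joint density. -/
lemma exists_isJointDensity [MeasurableSpace.CountableOrCountablyGenerated X Y]
    (hac : μ ⊗ₘ κ ≪ μ.prod (κ ∘ₘ μ)) :
    ∃ r : X → Y → ℝ≥0∞, IsJointDensity μ κ r ∧
      ∀ᵐ p ∂(μ ⊗ₘ κ), infoDensity μ κ p = Real.logb 2 (r p.1 p.2).toReal := by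
  classical
  set Q := κ ∘ₘ μ with hQ
  set η : Kernel X Y := Kernel.const X Q with hη
  set R := Kernel.rnDeriv κ η with hR
  have hRm : Measurable (fun p : X × Y => R p.1 p.2) := Kernel.measurable_rnDeriv κ η
  rw [← Measure.compProd_const, Measure.absolutelyContinuous_compProd_right_iff] at hac
  set G : Set X := {x | κ x ≪ η x} with hG
  have hGm : MeasurableSet G := Kernel.measurableSet_absolutelyContinuous κ η
  -- the value `1` on the null set outside `G` keeps every section a probability density
  set r : X → Y → ℝ≥0∞ := fun x y => if x ∈ G then ((R x y).toNNReal : ℝ≥0∞) else 1 with hr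
  have hrm : Measurable (Function.uncurry r) :=
    Measurable.ite (measurable_fst hGm) hRm.ennreal_toNNReal.coe_nnreal_ennreal measurable_const
  have hrR : ∀ x ∈ G, r x =ᵐ[Q] R x := fun x hx => by
    filter_upwards [Kernel.rnDeriv_ne_top κ η (a := x)] with y hy
    simp only [hr, if_pos hx]
    exact ENNReal.coe_toNNReal hy
  have hwd : ∀ x ∈ G, Q.withDensity (r x) = κ x := fun x hx => by
    rw [MeasureTheory.withDensity_congr_ae (hrR x hx), ← Kernel.withDensity_rnDeriv_eq hx,
      Kernel.withDensity_apply _ hRm]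
    rfl
  refine ⟨r, ⟨hrm, fun x y => ?_, fun x => ?_, ?_⟩, ?_⟩
  · simp only [hr]; split_ifs <;> simp
  · by_cases hx : x ∈ G
    · have h := congrArg (fun m => m Set.univ) (hwd x hx)
      simpa [withDensity_apply] using h
    · simp [hr, hx]
  · ext S hS
    rw [withDensity_apply _ hS, ← lintegral_indicator hS, lintegral_prod _
      (hrm.indicator hS).aemeasurable, Measure.compProd_apply hS]
    refine lintegral_congr_ae ?_
    filter_upwards [hac] with x hx
    rw [← hwd x hx, withDensity_apply _ (measurable_prodMk_left hS),
      ← lintegral_indicator (measurable_prodMk_left hS)]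
    rfl
  · refine Measure.ae_compProd_of_ae_ae (measurableSet_eq_fun ?_ ?_) ?_
    · exact hRm.ennreal_toReal.log.div_const _
    · exact (Measurable.log (Measurable.ennreal_toReal hrm)).div_const _
    filter_upwards [hac] with x hx
    filter_upwards [hx.ae_le (hrR x hx)] with y hy
    simp only [infoDensity]
    rw [hy]

namespace IsJointDensity

variable {r : X → Y → ℝ≥0∞}

/-- For almost every output, the integral over the input is one as well. -/
lemma lintegral_left_eq_one (hr : IsJointDensity μ κ r) :
    ∀ᵐ y ∂(κ ∘ₘ μ), ∫⁻ x, r x y ∂μ = 1 := by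
  have hm : Measurable fun y => ∫⁻ x, r x y ∂μ :=
    Measurable.lintegral_prod_left' (f := Function.uncurry r) hr.measurable
  have h : (κ ∘ₘ μ).withDensity (fun y => ∫⁻ x, r x y ∂μ) = (κ ∘ₘ μ).withDensity 1 := by
    rw [withDensity_one]
    ext B hB
    conv_rhs => rw [← Measure.snd_compProd, Measure.snd_apply hB, ← hr.withDensity_eq,
      withDensity_apply _ (measurable_snd hB), ← lintegral_indicator (measurable_snd hB),
      lintegral_prod_symm' _ (hr.measurable.indicator (measurable_snd hB))]
    rw [withDensity_apply _ hB, ← lintegral_indicator hB]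
    refine lintegral_congr fun y => ?_
    by_cases hy : y ∈ B
    · rw [Set.indicator_of_mem hy]
      refine lintegral_congr fun x => ?_
      rw [Set.indicator_of_mem (by exact hy)]; rfl
    · rw [Set.indicator_of_notMem hy]
      symm
      have h0 : ∀ x, (Prod.snd ⁻¹' B).indicator (Function.uncurry r) (x, y) = 0 := fun x =>
        Set.indicator_of_notMem (by exact hy) _
      simp [h0]
  have := (withDensity_eq_iff_of_sigmaFinite hm.aemeasurable measurable_one.aemeasurable).1 h
  exact this

/-- The law of a block of independent input-output pairs has the product density. -/
lemma pi_eq_map (hr : IsJointDensity μ κ r) (n : ℕ) :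
    Measure.map (fun (p : (Fin n → X) × (Fin n → Y)) i => (p.1 i, p.2 i))
      (((Measure.pi fun _ : Fin n => μ).prod (Measure.pi fun _ : Fin n => κ ∘ₘ μ)).withDensity
        fun p => ∏ i, r (p.1 i) (p.2 i)) = Measure.pi fun _ : Fin n => μ ⊗ₘ κ := by
  set e := MeasurableEquiv.arrowProdEquivProdArrow X Y (Fin n) with he
  have hmp := (measurePreserving_arrowProdEquivProdArrow X Y (Fin n) (fun _ => μ)
    (fun _ => κ ∘ₘ μ)).symm
  have hs : SigmaFinite ((μ.prod (κ ∘ₘ μ)).withDensity (Function.uncurry r)) := by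
    rw [hr.withDensity_eq]; infer_instance
  have hF : Measurable fun ω : Fin n → X × Y => ∏ i, Function.uncurry r (ω i) :=
    Finset.measurable_prod _ fun i _ => hr.measurable.comp (measurable_pi_apply i)
  rw [← hr.withDensity_eq, pi_withDensity _ hr.measurable, ← hmp.map_eq]
  change Measure.map e.symm _ = _
  ext S hS
  rw [MeasurableEquiv.map_apply, withDensity_apply _ (e.symm.measurable hS),
    withDensity_apply _ hS, setLIntegral_map hS hF e.symm.measurable]
  rfl

end IsJointDensity

/-- The information density is integrable, and its mean is the mutual information. -/
lemma integrable_infoDensity [MeasurableSpace.CountableOrCountablyGenerated X Y]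
    (hI : mutualInfo μ κ ≠ ⊤) :
    μ ⊗ₘ κ ≪ μ.prod (κ ∘ₘ μ) ∧ Integrable (infoDensity μ κ) (μ ⊗ₘ κ) ∧
      ∫ p, infoDensity μ κ p ∂(μ ⊗ₘ κ) = (mutualInfo μ κ).toReal := by
  have hlog : 0 < Real.log 2 := Real.log_pos one_lt_two
  have hkl : InformationTheory.klDiv (μ ⊗ₘ κ) (μ.prod (κ ∘ₘ μ)) ≠ ⊤ := fun h => hI (by
    rw [mutualInfo, h, ENNReal.top_div_of_ne_top ENNReal.ofReal_ne_top])
  obtain ⟨hac, hint⟩ := InformationTheory.klDiv_ne_top_iff.1 hkl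
  obtain ⟨r, hr, hir⟩ := exists_isJointDensity hac
  have hae : ∀ᵐ p ∂(μ ⊗ₘ κ), infoDensity μ κ p
      = llr (μ ⊗ₘ κ) (μ.prod (κ ∘ₘ μ)) p / Real.log 2 := by
    have h1 := Measure.rnDeriv_withDensity (μ.prod (κ ∘ₘ μ)) hr.measurable
    rw [hr.withDensity_eq] at h1
    filter_upwards [hir, hac.ae_le h1] with p hp hp1
    rw [hp, llr, hp1, Real.logb]
    rfl
  refine ⟨hac, (hint.div_const _).congr (hae.mono fun p hp => hp.symm), ?_⟩
  rw [integral_congr_ae hae, integral_div, mutualInfo, ENNReal.toReal_div,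
    InformationTheory.toReal_klDiv_of_measure_eq hac (by simp),
    ENNReal.toReal_ofReal hlog.le]

end Density

/-! ### The converse bound -/

section Converse

variable {X : Type u} {Y : Type v} [MeasurableSpace X] [MeasurableSpace Y]

lemma ae_pi_forall {Ω : Type*} [MeasurableSpace Ω] {ν : Measure Ω} [IsProbabilityMeasure ν]
    {p : Ω → Prop} (h : ∀ᵐ x ∂ν, p x) (n : ℕ) :
    ∀ᵐ ω ∂(Measure.pi fun _ : Fin n => ν), ∀ i, p (ω i) :=
  ae_all_iff.2 fun i =>
    (Measure.quasiMeasurePreserving_eval (fun _ : Fin n => ν) i).ae h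

lemma integral_pi_sum {Ω : Type*} [MeasurableSpace Ω] {ν : Measure Ω} [IsProbabilityMeasure ν]
    {f : Ω → ℝ} (hf : Integrable f ν) (n : ℕ) :
    Integrable (fun ω : Fin n → Ω => ∑ i, f (ω i)) (Measure.pi fun _ : Fin n => ν) ∧
      ∫ ω, ∑ i, f (ω i) ∂(Measure.pi fun _ : Fin n => ν) = n * ∫ x, f x ∂ν := by
  have hi : ∀ i : Fin n, Integrable (fun ω : Fin n → Ω => f (ω i)) (Measure.pi fun _ => ν) :=
    fun i => (measurePreserving_eval (fun _ : Fin n => ν) i).integrable_comp_of_integrable hf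
  refine ⟨integrable_finsetSum _ fun i _ => hi i, ?_⟩
  rw [integral_finsetSum _ fun i _ => hi i]
  have : ∀ i : Fin n, ∫ ω, f (ω i) ∂(Measure.pi fun _ : Fin n => ν) = ∫ x, f x ∂ν := fun i => by
    have hmp := measurePreserving_eval (fun _ : Fin n => ν) i
    have h := integral_map (f := f) hmp.measurable.aemeasurable
      (by rw [hmp.map_eq]; exact hf.aestronglyMeasurable)
    rw [hmp.map_eq] at h
    exact h.symm
  simp [this]

namespace Code

variable {n : ℕ} (c : Code.{u, v, w} X Y n)

lemma measurable_length :
    Measurable fun p : (Fin n → X) × c.U => (c.enc p.1 p.2).length :=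
  measurable_to_countable' fun l => by
    have : (fun p : (Fin n → X) × c.U => (c.enc p.1 p.2).length) ⁻¹' {l}
        = ⋃ s ∈ {s : List Bool | s.length = l}, {p | c.enc p.1 p.2 = s} := by
      ext p; simp
    rw [this]
    exact MeasurableSet.biUnion (Set.to_countable _) fun s _ => c.measurable_enc s

lemma measurable_output : Measurable fun p : (Fin n → X) × c.U => c.dec (c.enc p.1 p.2) p.2 := by
  intro B hB
  have : (fun p : (Fin n → X) × c.U => c.dec (c.enc p.1 p.2) p.2) ⁻¹' B
      = ⋃ s, {p | c.enc p.1 p.2 = s} ∩ {p | c.dec s p.2 ∈ B} := by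
    ext p; simp
  rw [this]
  exact MeasurableSet.iUnion fun s => (c.measurable_enc s).inter
    ((c.measurable_dec s).comp measurable_snd hB)

/-- The Kraft inequality makes the decoder's output, weighted by the codeword lengths, no more
correlated with the source than an independent output would be: for each value of the common
randomness the decoder chooses among fixed words of total weight at most one. -/
lemma lintegral_prod_mul_pow_length_le (μ : Measure X) [IsProbabilityMeasure μ]
    {r : X → Y → ℝ≥0∞} (hr : Measurable (Function.uncurry r))
    (hr1 : ∀ y, ∫⁻ x, r x y ∂μ ≤ 1) :
    ∫⁻ p, (∏ i, r (p.1 i) (c.dec (c.enc p.1 p.2) p.2 i)) * 2⁻¹ ^ (c.enc p.1 p.2).length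
      ∂((Measure.pi fun _ : Fin n => μ).prod c.ν) ≤ 1 := by
  have hm : Measurable fun p : (Fin n → X) × c.U =>
      (∏ i, r (p.1 i) (c.dec (c.enc p.1 p.2) p.2 i)) * (2⁻¹ : ℝ≥0∞) ^ (c.enc p.1 p.2).length := by
    refine Measurable.mul (Finset.measurable_prod _ fun i _ => ?_)
      ((measurable_from_top (f := fun l : ℕ => (2⁻¹ : ℝ≥0∞) ^ l)).comp c.measurable_length)
    exact hr.comp (((measurable_pi_apply i).comp measurable_fst).prodMk
      ((measurable_pi_apply i).comp c.measurable_output))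
  rw [lintegral_prod_symm' _ hm]
  refine (lintegral_mono (g := fun _ => 1) fun a => ?_).trans (by simp)
  set S : Set (List Bool) := Set.range fun x => c.enc x a with hS
  have hm' : ∀ s, Measurable fun x : Fin n → X => ∏ i, r (x i) (c.dec s a i) := fun s =>
    Finset.measurable_prod _ fun i _ =>
      show Measurable (Function.uncurry r ∘ fun x : Fin n → X => (x i, c.dec s a i)) from
        hr.comp ((measurable_pi_apply i).prodMk measurable_const)
  calc _ ≤ ∫⁻ x, ∑' s, S.indicator (fun s : List Bool => (2⁻¹ : ℝ≥0∞) ^ s.length) s *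
        ∏ i, r (x i) (c.dec s a i) ∂(Measure.pi fun _ : Fin n => μ) := by
        refine lintegral_mono fun x => ?_
        refine le_trans ?_ (ENNReal.le_tsum (c.enc x a))
        rw [Set.indicator_of_mem (Set.mem_range_self x), mul_comm]
    _ = ∑' s, S.indicator (fun s : List Bool => (2⁻¹ : ℝ≥0∞) ^ s.length) s *
        ∏ i, ∫⁻ x, r x (c.dec s a i) ∂μ := by
        rw [lintegral_tsum fun s => ((hm' s).const_mul _).aemeasurable]
        refine tsum_congr fun s => ?_
        rw [lintegral_const_mul _ (hm' s)]
        rw [lintegral_pi_prod (f := fun i x => r x (c.dec s a i))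
          fun i => hr.comp measurable_prodMk_right]
    _ ≤ ∑' s, S.indicator (fun s : List Bool => (2⁻¹ : ℝ≥0∞) ^ s.length) s := by
        refine ENNReal.tsum_le_tsum fun s => ?_
        exact mul_le_of_le_one_right' (Finset.prod_le_one' fun i _ => hr1 _)
    _ ≤ 1 := kraft_tsum_le_one (by
        rintro _ ⟨x, rfl⟩ _ ⟨x', rfl⟩ h
        exact c.prefix_free a x x' h)

/-- The converse bound: no simulating code has a rate below the mutual information. -/
lemma mutualInfo_le_rate [MeasurableSpace.CountableOrCountablyGenerated X Y]
    {μ : Measure X} [IsProbabilityMeasure μ] {κ : Kernel X Y} [IsMarkovKernel κ] (hn : n ≠ 0)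
    (hI : mutualInfo μ κ ≠ ⊤) (hc : c.Simulates μ κ) : mutualInfo μ κ ≤ c.rate μ := by
  classical
  obtain ⟨hac, hint, hmean⟩ := integrable_infoDensity hI
  obtain ⟨r₀, hr₀, hir⟩ := exists_isJointDensity hac
  -- a version of the density with good sections at all outputs
  set good : Set Y := {y | ∫⁻ x, r₀ x y ∂μ ≤ 1} with hgood
  have hgm : MeasurableSet good := measurableSet_le
    (Measurable.lintegral_prod_left' (f := Function.uncurry r₀) hr₀.measurable) measurable_const
  set r : X → Y → ℝ≥0∞ := fun x y => if y ∈ good then r₀ x y else 0 with hr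
  have hrm : Measurable (Function.uncurry r) :=
    Measurable.ite (measurable_snd hgm) hr₀.measurable measurable_const
  have hr1 : ∀ y, ∫⁻ x, r x y ∂μ ≤ 1 := fun y => by
    by_cases hy : y ∈ good
    · simp only [hr, if_pos hy]; exact hy
    · simp [hr, hy]
  have hrt : ∀ x y, r x y ≠ ⊤ := fun x y => by
    simp only [hr]; split_ifs
    exacts [hr₀.ne_top x y, ENNReal.zero_ne_top]
  have hae : ∀ᵐ p ∂(μ ⊗ₘ κ), r p.1 p.2 ≠ 0 ∧
      infoDensity μ κ p = Real.logb 2 (r p.1 p.2).toReal := by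
    have h1 : ∀ᵐ p ∂(μ ⊗ₘ κ), p.2 ∈ good := by
      have h2 : ∀ᵐ y ∂(μ ⊗ₘ κ).snd, y ∈ good := by
        rw [Measure.snd_compProd]
        exact hr₀.lintegral_left_eq_one.mono fun y hy => hy.le
      exact ae_of_ae_map measurable_snd.aemeasurable h2
    filter_upwards [h1, hr₀.ae_ne_zero, hir] with p h1 h2 h3
    simp only [hr, if_pos h1]
    exact ⟨h2, h3⟩
  set Ω := (Fin n → X) × c.U
  set ρ : Measure Ω := (Measure.pi fun _ : Fin n => μ).prod c.ν with hρ
  set len : Ω → ℕ := fun p => (c.enc p.1 p.2).length with hlen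
  set ψ : Ω → Fin n → X × Y := fun p i => (p.1 i, c.dec (c.enc p.1 p.2) p.2 i) with hψ
  have hψm : Measurable ψ := measurable_pi_lambda _ fun i =>
    ((measurable_pi_apply i).comp measurable_fst).prodMk
      ((measurable_pi_apply i).comp c.measurable_output)
  have hψmap : Measure.map ψ ρ = Measure.pi fun _ : Fin n => μ ⊗ₘ κ := hc
  have hnn : (n : ℝ≥0∞) ≠ 0 := by exact_mod_cast hn
  rw [rate, ENNReal.le_div_iff_mul_le (Or.inl hnn) (Or.inl (ENNReal.natCast_ne_top n))]
  rcases eq_or_ne (∫⁻ p, (len p : ℝ≥0∞) ∂ρ) ⊤ with htop | htop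
  · exact le_of_le_of_eq le_top htop.symm
  have hlm : Measurable fun p => (len p : ℝ) :=
    (measurable_from_top (f := fun l : ℕ => (l : ℝ))).comp c.measurable_length
  have hof : ∀ p, ENNReal.ofReal (len p : ℝ) = (len p : ℝ≥0∞) := fun p => ENNReal.ofReal_natCast _
  have hli : Integrable (fun p => (len p : ℝ)) ρ := by
    refine ⟨hlm.aestronglyMeasurable, ?_⟩
    rw [hasFiniteIntegral_iff_ofReal (ae_of_all _ fun p => Nat.cast_nonneg _)]
    simp_rw [hof]
    exact htop.lt_top
  have hlI : ∫ p, (len p : ℝ) ∂ρ = (∫⁻ p, (len p : ℝ≥0∞) ∂ρ).toReal := by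
    rw [integral_eq_lintegral_of_nonneg_ae (ae_of_all _ fun p => Nat.cast_nonneg _)
      hlm.aestronglyMeasurable]
    simp_rw [hof]
  set F : (Fin n → X × Y) → ℝ := fun ω => ∑ i, infoDensity μ κ (ω i) with hF
  obtain ⟨hFi, hFI⟩ := integral_pi_sum hint n
  rw [← hψmap] at hFi
  have hFi' : Integrable (fun p => F (ψ p)) ρ := hFi.comp_measurable hψm
  have hFI' : ∫ p, F (ψ p) ∂ρ = n * (mutualInfo μ κ).toReal := by
    rw [← integral_map hψm.aemeasurable hFi.aestronglyMeasurable, hψmap, hFI, hmean]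
  set z : Ω → ℝ≥0∞ := fun p =>
    (∏ i, r (ψ p i).1 (ψ p i).2) * (2⁻¹ : ℝ≥0∞) ^ len p with hz
  have hzm : Measurable z := by
    refine Measurable.mul (Finset.measurable_prod _ fun i _ => ?_)
      ((measurable_from_top (f := fun l : ℕ => (2⁻¹ : ℝ≥0∞) ^ l)).comp c.measurable_length)
    exact hrm.comp ((measurable_pi_apply i).comp hψm)
  have hz1 : ∫⁻ p, z p ∂ρ ≤ 1 := c.lintegral_prod_mul_pow_length_le μ hrm hr1
  have hzi : Integrable (fun p => (z p).toReal) ρ :=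
    integrable_toReal_of_lintegral_ne_top hzm.aemeasurable
      (hz1.trans_lt ENNReal.one_lt_top).ne
  have hzI : ∫ p, (z p).toReal ∂ρ ≤ 1 := by
    rw [integral_toReal hzm.aemeasurable (ae_lt_top hzm (hz1.trans_lt ENNReal.one_lt_top).ne)]
    exact ENNReal.toReal_le_of_le_ofReal zero_le_one (by simpa using hz1)
  have hlog : 0 < Real.log 2 := Real.log_pos one_lt_two
  have hpt : ∀ᵐ p ∂ρ, (F (ψ p) - len p) * Real.log 2 ≤ (z p).toReal - 1 := by
    have h1 := ae_pi_forall hae n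
    rw [← hψmap] at h1
    filter_upwards [ae_of_ae_map hψm.aemeasurable h1] with p hp
    have hpos : ∀ i, 0 < (r (ψ p i).1 (ψ p i).2).toReal := fun i =>
      ENNReal.toReal_pos (hp i).1 (hrt _ _)
    have hzr : (z p).toReal = (∏ i, (r (ψ p i).1 (ψ p i).2).toReal) * (2⁻¹ : ℝ) ^ len p := by
      simp [hz, ENNReal.toReal_mul, ENNReal.toReal_prod]
    have hprod : 0 < ∏ i, (r (ψ p i).1 (ψ p i).2).toReal := Finset.prod_pos fun i _ => hpos i
    have hzpos : 0 < (z p).toReal := by rw [hzr]; positivity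
    have hzlog : Real.log (z p).toReal = (F (ψ p) - len p) * Real.log 2 := by
      rw [hzr, Real.log_mul hprod.ne' (by positivity), Real.log_pow, Real.log_inv,
        Real.log_prod fun i _ => (hpos i).ne']
      simp only [hF, sub_mul, Finset.sum_mul]
      have : ∀ i, infoDensity μ κ (ψ p i) * Real.log 2
          = Real.log (r (ψ p i).1 (ψ p i).2).toReal := fun i => by
        rw [(hp i).2, Real.logb, div_mul_cancel₀ _ hlog.ne']
      simp only [this]; ring
    rw [← hzlog]
    exact Real.log_le_sub_one_of_pos hzpos
  have hle := integral_mono_ae ((hFi'.sub hli).mul_const (Real.log 2))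
    (hzi.sub (integrable_const 1)) hpt
  have e1 : ∫ p, (F (ψ p) - len p) * Real.log 2 ∂ρ
      = (∫ p, F (ψ p) ∂ρ - ∫ p, (len p : ℝ) ∂ρ) * Real.log 2 := by
    rw [integral_mul_const, integral_sub hFi' hli]
  have e2 : ∫ p, ((z p).toReal - 1) ∂ρ = ∫ p, (z p).toReal ∂ρ - 1 := by
    rw [integral_sub hzi (integrable_const 1)]; simp
  have hle' : (∫ p, F (ψ p) ∂ρ - ∫ p, (len p : ℝ) ∂ρ) * Real.log 2
      ≤ ∫ p, (z p).toReal ∂ρ - 1 := by rw [← e1, ← e2]; exact hle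
  have hfinal : (mutualInfo μ κ).toReal * n ≤ (∫⁻ p, (len p : ℝ≥0∞) ∂ρ).toReal := by
    rw [← hlI]; nlinarith
  rw [← ENNReal.toReal_le_toReal (ENNReal.mul_ne_top hI (ENNReal.natCast_ne_top n)) htop,
    ENNReal.toReal_mul, ENNReal.toReal_natCast]
  exact hfinal

end Code

end Converse

/-! ### Codes from greedy rejection sampling -/

section BlockDensity

variable {X : Type u} {Y : Type v}

/-- The density of the law of a block of input-output pairs with respect to independent blocks. -/
def blockDensity (r : X → Y → ℝ≥0∞) (n : ℕ) (x : Fin n → X) (y : Fin n → Y) : ℝ≥0∞ :=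
  ∏ i, r (x i) (y i)

/-- `log₂ (1 + R)` for the block density `R`: a nonnegative substitute for the information density
of a block. -/
def blockLog (r : X → Y → ℝ≥0∞) (n : ℕ) (x : Fin n → X) (y : Fin n → Y) : ℝ :=
  Real.logb 2 (1 + (blockDensity r n x y).toReal)

lemma blockLog_nonneg (r : X → Y → ℝ≥0∞) (n : ℕ) (x : Fin n → X) (y : Fin n → Y) :
    0 ≤ blockLog r n x y :=
  Real.logb_nonneg one_lt_two (by linarith [ENNReal.toReal_nonneg (a := blockDensity r n x y)])

end BlockDensity

section Achievability

variable {X : Type u} {Y : Type v} [MeasurableSpace X] [MeasurableSpace Y]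
variable {μ : Measure X} [IsProbabilityMeasure μ] {κ : Kernel X Y} [IsMarkovKernel κ]

lemma measurable_blockDensity {r : X → Y → ℝ≥0∞} (hr : Measurable (Function.uncurry r)) (n : ℕ) :
    Measurable (Function.uncurry (blockDensity r n)) := by
  change Measurable fun p : (Fin n → X) × (Fin n → Y) => ∏ i, r (p.1 i) (p.2 i)
  exact Finset.measurable_prod _ fun i _ =>
    show Measurable (Function.uncurry r ∘ fun p : (Fin n → X) × (Fin n → Y) => (p.1 i, p.2 i)) from
      hr.comp (((measurable_pi_apply i).comp measurable_fst).prodMk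
        ((measurable_pi_apply i).comp measurable_snd))

/-- The rate of greedy rejection sampling with a prefix-free code `C` for the index of the accepted
proposal. In `hlen`, `m` stands for the position of the proposal within its level and `s` for the
survival probability; the inequality between them is the one of `survival_mul_le`. The value `⊤` of
`a` exempts exceptional pairs `(x, y)` from the length bound. -/
lemma minRate_le {r : X → Y → ℝ≥0∞} (hr : IsJointDensity μ κ r) (n : ℕ)
    {lev : (Fin n → Y) → ℕ} (hlev : Measurable lev)
    {C : ℕ → List Bool} (hC : ∀ i j, C i <+: C j → i = j)
    {a : (Fin n → X) → (Fin n → Y) → ℝ≥0∞} (ha : Measurable (Function.uncurry a))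
    {b : ℝ} (hb : 0 ≤ b)
    (hlen : ∀ x y (m : ℕ) (s : ℝ), 0 < s → s ≤ 1 → ENNReal.ofReal s * m ≤ blockDensity r n x y *
      (Measure.pi fun _ : Fin n => κ ∘ₘ μ) (lev ⁻¹' {lev y}) →
      ((C (Nat.pair (lev y) m)).length : ℝ≥0∞) ≤ a x y + ENNReal.ofReal (b / √s)) :
    minRate μ κ n ≤ (∫⁻ ω, a (fun i => (ω i).1) (fun i => (ω i).2)
      ∂(Measure.pi fun _ : Fin n => μ ⊗ₘ κ) + ENNReal.ofReal (2 * b)) / n := by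
  set Q : Measure (Fin n → Y) := Measure.pi fun _ : Fin n => κ ∘ₘ μ with hQ
  set M : Measure (Fin n → X) := Measure.pi fun _ : Fin n => μ with hM
  set R := blockDensity r n with hR
  have hRm : Measurable (Function.uncurry R) := measurable_blockDensity hr.measurable n
  have hRx : ∀ x, Measurable (R x) := fun x => hRm.comp measurable_prodMk_left
  have hRt : ∀ x y, R x y ≠ ⊤ := fun x y => ENNReal.prod_ne_top fun i _ => hr.ne_top _ _
  have hR1 : ∀ x, ∫⁻ y, R x y ∂Q = 1 := fun x => by
    rw [hQ]
    refine (lintegral_pi_prod (f := fun i y => r (x i) y)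
      fun i => hr.measurable_section _).trans ?_
    simp [hr.lintegral_eq_one]
  have hinj : Function.Injective C := fun i j h => hC i j (h ▸ List.prefix_rfl)
  have hKm := measurable_firstAccepted (Q := Q) hRm hlev
  set N := randomness Q lev with hN
  let c : Code.{u, v, max u v} X Y n :=
    { U := ULift.{u} (ℕ → (Fin n → Y) × unitInterval)
      mU := inferInstance
      ν := N.map MeasurableEquiv.ulift.symm
      isProb := Measure.isProbabilityMeasure_map (MeasurableEquiv.measurable _).aemeasurable
      enc := fun x u => C (firstAccepted Q lev (R x) u.down)
      dec := fun s u => (u.down (Function.invFun C s)).1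
      measurable_enc := fun s => by
        have h : Measurable fun p : (Fin n → X) × ULift.{u} (ℕ → (Fin n → Y) × unitInterval) =>
            firstAccepted Q lev (R p.1) p.2.down :=
          hKm.comp (measurable_fst.prodMk (measurable_down.comp measurable_snd))
        exact h (t := {j | C j = s}) trivial
      measurable_dec := fun s =>
        measurable_fst.comp ((measurable_pi_apply _).comp measurable_down)
      prefix_free := fun u x x' h => by rw [hC _ _ h] }
  have hν : ∀ f : (Fin n → X) × c.U → ℝ≥0∞, Measurable f →
      ∫⁻ p, f p ∂(M.prod c.ν) = ∫⁻ x, ∫⁻ u, f (x, ULift.up u) ∂N ∂M := fun f hf => by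
    rw [lintegral_prod _ hf.aemeasurable]
    refine lintegral_congr fun x => ?_
    exact lintegral_map_equiv _ MeasurableEquiv.ulift.symm
  have hout : ∀ (x : Fin n → X) (u : ℕ → (Fin n → Y) × unitInterval),
      c.dec (c.enc x (ULift.up u)) (ULift.up u) = (u (firstAccepted Q lev (R x) u)).1 :=
    fun x u => by
      change (u (Function.invFun C (C (firstAccepted Q lev (R x) u)))).1 = _
      rw [Function.leftInverse_invFun hinj]
  -- conditionally on the source block, the accepted proposal has density `R x`
  have hlaw : Measure.map (fun p : (Fin n → X) × c.U => (p.1, c.dec (c.enc p.1 p.2) p.2))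
      (M.prod c.ν) = (M.prod Q).withDensity (Function.uncurry R) := by
    have hm : Measurable fun p : (Fin n → X) × c.U => (p.1, c.dec (c.enc p.1 p.2) p.2) :=
      measurable_fst.prodMk c.measurable_output
    ext S hS
    rw [← lintegral_indicator_one hS, lintegral_map (measurable_one.indicator hS) hm,
      hν (fun p => S.indicator 1 (p.1, c.dec (c.enc p.1 p.2) p.2))
        ((measurable_one.indicator hS).comp hm), withDensity_apply _ hS,
      ← lintegral_indicator hS, lintegral_prod _ (hRm.indicator hS).aemeasurable]
    refine lintegral_congr fun x => ?_
    simp only [hout]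
    rw [lintegral_accepted_value (hRx x) hlev (hRt x) (hR1 x)
      (g := fun y => S.indicator 1 (x, y))
      ((measurable_one.indicator hS).comp measurable_prodMk_left)]
    refine lintegral_congr fun y => ?_
    by_cases h : (x, y) ∈ S
    · simp [h]
    · simp [h]
  have hzip : Measurable fun (p : (Fin n → X) × (Fin n → Y)) i => (p.1 i, p.2 i) :=
    measurable_pi_lambda _ fun i => ((measurable_pi_apply i).comp measurable_fst).prodMk
      ((measurable_pi_apply i).comp measurable_snd)
  have hsim : c.Simulates μ κ := by
    unfold Code.Simulates
    rw [← hr.pi_eq_map n]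
    change _ = Measure.map _ ((M.prod Q).withDensity (Function.uncurry R))
    rw [← hlaw, Measure.map_map hzip (measurable_fst.prodMk c.measurable_output)]
    rfl
  refine (iInf₂_le c hsim).trans ?_
  unfold Code.rate
  refine ENNReal.div_le_div_right ?_ _
  rw [hν (fun p => ((c.enc p.1 p.2).length : ℝ≥0∞))
    ((measurable_from_top (f := fun l : ℕ => (l : ℝ≥0∞))).comp c.measurable_length)]
  calc _ ≤ ∫⁻ x, (∫⁻ y, R x y * a x y ∂Q + ENNReal.ofReal (2 * b)) ∂M :=
        lintegral_mono fun x => lintegral_length_firstAccepted_le (hRx x) hlev (hRt x) (hR1 x) C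
          (ha.comp measurable_prodMk_left) hb (hlen x)
    _ = ∫⁻ x, ∫⁻ y, R x y * a x y ∂Q ∂M + ENNReal.ofReal (2 * b) := by
        rw [lintegral_add_right _ measurable_const]; simp
    _ = _ := by
        congr 1
        rw [← hr.pi_eq_map n, lintegral_map _ hzip]
        · change _ = ∫⁻ p, Function.uncurry a p ∂((M.prod Q).withDensity (Function.uncurry R))
          rw [lintegral_withDensity_eq_lintegral_mul _ hRm ha,
            lintegral_prod _ (hRm.mul ha).aemeasurable]
          rfl
        · exact ha.comp ((measurable_pi_lambda _ fun i => measurable_fst.comp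
            (measurable_pi_apply i)).prodMk (measurable_pi_lambda _ fun i =>
              measurable_snd.comp (measurable_pi_apply i)))

end Achievability

/-! ### The information density of a block -/

section BlockInformation

variable {X : Type u} {Y : Type v} [MeasurableSpace X] [MeasurableSpace Y]
variable {μ : Measure X} [IsProbabilityMeasure μ] {κ : Kernel X Y} [IsMarkovKernel κ]

lemma measurable_blockLog {r : X → Y → ℝ≥0∞} (hr : Measurable (Function.uncurry r)) (n : ℕ) :
    Measurable (Function.uncurry (blockLog r n)) :=
  (((measurable_blockDensity hr n).ennreal_toReal.const_add 1).log).div_const _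

lemma measurable_unzip (n : ℕ) : Measurable fun ω : Fin n → X × Y =>
    ((fun i => (ω i).1, fun i => (ω i).2) : (Fin n → X) × (Fin n → Y)) :=
  (measurable_pi_lambda _ fun i => measurable_fst.comp (measurable_pi_apply i)).prodMk
    (measurable_pi_lambda _ fun i => measurable_snd.comp (measurable_pi_apply i))

lemma two_thirds_lt_log_two : 2 / 3 < Real.log 2 := by
  have := Real.log_two_gt_d9; linarith

lemma logb_two_le {t : ℝ} (ht : 0 < t) : Real.logb 2 t ≤ 3 / 2 * t := by
  have h := two_thirds_lt_log_two
  rw [Real.logb, div_le_iff₀ (by linarith)]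
  have := Real.log_le_sub_one_of_pos ht
  nlinarith

lemma logb_two_one_add_le {t : ℝ} (ht : 0 ≤ t) : Real.logb 2 (1 + t) ≤ 3 / 2 * t := by
  have h := two_thirds_lt_log_two
  rw [Real.logb, div_le_iff₀ (by linarith)]
  have := Real.log_le_sub_one_of_pos (show 0 < 1 + t by linarith)
  nlinarith

lemma neg_logb_two_le_div_sqrt {s : ℝ} (hs : 0 < s) : - Real.logb 2 s ≤ 3 / √s := by
  have h1 : 0 < √s := Real.sqrt_pos.2 hs
  have h2 := logb_two_le (t := (√s)⁻¹) (by positivity)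
  have h3 : Real.logb 2 s = 2 * Real.logb 2 (√s) := by
    conv_lhs => rw [← Real.sq_sqrt hs.le]
    rw [Real.logb_pow]; norm_num
  rw [Real.logb_inv] at h2
  rw [h3, div_eq_mul_inv]; linarith

namespace IsJointDensity

variable {r : X → Y → ℝ≥0∞}

/-- Under the law of the block, the reciprocal of the block density has mean at most one. -/
lemma lintegral_prod_inv_le (hr : IsJointDensity μ κ r) (n : ℕ) :
    ∫⁻ ω, ∏ i, (r (ω i).1 (ω i).2)⁻¹ ∂(Measure.pi fun _ : Fin n => μ ⊗ₘ κ) ≤ 1 := by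
  refine (lintegral_pi_prod (ν := fun _ : Fin n => μ ⊗ₘ κ)
    (f := fun _ p => (r p.1 p.2)⁻¹) fun i => hr.measurable.inv).le.trans ?_
  refine Finset.prod_le_one' fun i _ => ?_
  rw [← hr.withDensity_eq, lintegral_withDensity_eq_lintegral_mul _ hr.measurable
    (g := fun p => (r p.1 p.2)⁻¹) hr.measurable.inv]
  refine (lintegral_mono (g := fun _ => 1) fun p => ENNReal.mul_inv_le_one _).trans ?_
  simp

/-- The excess of `log₂ (1 + R)` over the information density of the block, with a bound that is
integrable uniformly in the block length. -/
lemma ae_blockLog [MeasurableSpace.CountableOrCountablyGenerated X Y] (hr : IsJointDensity μ κ r)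
    (hir : ∀ᵐ p ∂(μ ⊗ₘ κ), infoDensity μ κ p = Real.logb 2 (r p.1 p.2).toReal) (n : ℕ) :
    ∀ᵐ ω ∂(Measure.pi fun _ : Fin n => μ ⊗ₘ κ),
      0 < (blockDensity r n (fun i => (ω i).1) (fun i => (ω i).2)).toReal ∧
      Real.logb 2 (blockDensity r n (fun i => (ω i).1) (fun i => (ω i).2)).toReal
        = ∑ i, infoDensity μ κ (ω i) ∧
      ∑ i, infoDensity μ κ (ω i) ≤ blockLog r n (fun i => (ω i).1) (fun i => (ω i).2) ∧
      blockLog r n (fun i => (ω i).1) (fun i => (ω i).2) ≤ ∑ i, infoDensity μ κ (ω i) +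
        3 / 2 * (∏ i, (r (ω i).1 (ω i).2)⁻¹).toReal := by
  filter_upwards [ae_pi_forall (hr.ae_ne_zero.and hir) n] with ω hω
  have hpos : ∀ i, 0 < (r (ω i).1 (ω i).2).toReal := fun i =>
    ENNReal.toReal_pos (hω i).1 (hr.ne_top _ _)
  set R := (blockDensity r n (fun i => (ω i).1) (fun i => (ω i).2)).toReal with hR
  have hRe : R = ∏ i, (r (ω i).1 (ω i).2).toReal := by
    rw [hR, blockDensity, ENNReal.toReal_prod]
  have hRpos : 0 < R := by rw [hRe]; exact Finset.prod_pos fun i _ => hpos i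
  have hlogR : Real.logb 2 R = ∑ i, infoDensity μ κ (ω i) := by
    rw [hRe, Real.logb_prod _ _ fun i _ => (hpos i).ne']
    exact Finset.sum_congr rfl fun i _ => (hω i).2.symm
  have hinv : (∏ i, (r (ω i).1 (ω i).2)⁻¹).toReal = R⁻¹ := by
    rw [ENNReal.toReal_prod, hRe, ← Finset.prod_inv_distrib]
    exact Finset.prod_congr rfl fun i _ => ENNReal.toReal_inv _
  refine ⟨hRpos, hlogR, ?_, ?_⟩
  · rw [← hlogR]
    exact Real.logb_le_logb_of_le one_lt_two hRpos (by linarith)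
  · rw [← hlogR, hinv]
    have h1 : 1 + R = R * (1 + R⁻¹) := by
      rw [mul_add, mul_inv_cancel₀ hRpos.ne']; ring
    rw [blockLog, ← hR, h1, Real.logb_mul hRpos.ne' (by positivity)]
    have := logb_two_one_add_le (inv_nonneg.2 hRpos.le)
    linarith

/-- The mean of `log₂ (1 + R)` exceeds the mutual information of the block by at most a constant,
and deviations carry over from the information density to `log₂ (1 + R)`. -/
lemma lintegral_blockLog_le [MeasurableSpace.CountableOrCountablyGenerated X Y]
    (hr : IsJointDensity μ κ r)
    (hir : ∀ᵐ p ∂(μ ⊗ₘ κ), infoDensity μ κ p = Real.logb 2 (r p.1 p.2).toReal)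
    (hI : mutualInfo μ κ ≠ ⊤) (n : ℕ) :
    ∫⁻ ω, ENNReal.ofReal (blockLog r n (fun i => (ω i).1) (fun i => (ω i).2))
      ∂(Measure.pi fun _ : Fin n => μ ⊗ₘ κ) ≤ ENNReal.ofReal (n * (mutualInfo μ κ).toReal + 2) ∧
    ∫⁻ ω, ENNReal.ofReal |blockLog r n (fun i => (ω i).1) (fun i => (ω i).2) -
        n * (mutualInfo μ κ).toReal| ∂(Measure.pi fun _ : Fin n => μ ⊗ₘ κ)
      ≤ ENNReal.ofReal (∫ ω, |∑ i, infoDensity μ κ (ω i) - n * (mutualInfo μ κ).toReal|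
          ∂(Measure.pi fun _ : Fin n => μ ⊗ₘ κ) + 2) := by
  set P := Measure.pi fun _ : Fin n => μ ⊗ₘ κ with hP
  set J := (mutualInfo μ κ).toReal with hJ
  set L : (Fin n → X × Y) → ℝ := fun ω => blockLog r n (fun i => (ω i).1) (fun i => (ω i).2)
    with hL
  set F : (Fin n → X × Y) → ℝ := fun ω => ∑ i, infoDensity μ κ (ω i) with hF
  set V : (Fin n → X × Y) → ℝ := fun ω => (∏ i, (r (ω i).1 (ω i).2)⁻¹).toReal with hV
  have hae := hr.ae_blockLog hir n
  obtain ⟨-, hint, hmean⟩ := integrable_infoDensity hI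
  obtain ⟨hFi, hFI⟩ := integral_pi_sum hint n
  rw [hmean] at hFI
  have hVm : Measurable fun ω : Fin n → X × Y => ∏ i, (r (ω i).1 (ω i).2)⁻¹ :=
    Finset.measurable_prod _ fun i _ => (hr.measurable.comp (measurable_pi_apply i)).inv
  have hV1 := hr.lintegral_prod_inv_le n
  have hVi : Integrable V P := integrable_toReal_of_lintegral_ne_top hVm.aemeasurable
    (hV1.trans_lt ENNReal.one_lt_top).ne
  have hVI : ∫ ω, V ω ∂P ≤ 1 := by
    rw [integral_toReal hVm.aemeasurable (ae_lt_top hVm (hV1.trans_lt ENNReal.one_lt_top).ne)]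
    exact ENNReal.toReal_le_of_le_ofReal zero_le_one (by simpa using hV1)
  have bound : ∀ (f g : (Fin n → X × Y) → ℝ), 0 ≤ᵐ[P] g → Integrable g P → f ≤ᵐ[P] g →
      ∫⁻ ω, ENNReal.ofReal (f ω) ∂P ≤ ENNReal.ofReal (∫ ω, g ω ∂P) := fun f g h0 hg hfg => by
    rw [ofReal_integral_eq_lintegral_ofReal hg h0]
    exact lintegral_mono_ae (hfg.mono fun ω h => ENNReal.ofReal_le_ofReal h)
  constructor
  · refine (bound _ (fun ω => F ω + 3 / 2 * V ω) ?_ (hFi.add (hVi.const_mul _)) ?_).trans ?_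
    · filter_upwards [hae] with ω h
      exact (blockLog_nonneg _ _ _ _).trans h.2.2.2
    · filter_upwards [hae] with ω h using h.2.2.2
    · refine ENNReal.ofReal_le_ofReal ?_
      rw [integral_add hFi (hVi.const_mul _), integral_const_mul, hFI]
      linarith
  · have hFi' : Integrable (fun ω => |F ω - n * J|) P := (hFi.sub (integrable_const _)).abs
    refine (bound _ (fun ω => |F ω - n * J| + 3 / 2 * V ω) ?_ (hFi'.add (hVi.const_mul _)) ?_).trans
      ?_
    · refine ae_of_all _ fun ω => ?_
      have : 0 ≤ V ω := ENNReal.toReal_nonneg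
      simp only [Pi.zero_apply]; positivity
    · filter_upwards [hae] with ω h
      have h1 : |L ω - F ω| ≤ 3 / 2 * V ω := by
        rw [abs_of_nonneg (by linarith [h.2.2.1])]; linarith [h.2.2.2]
      have h2 := abs_sub_le (L ω) (F ω) (n * J)
      linarith
    · refine ENNReal.ofReal_le_ofReal ?_
      rw [integral_add hFi' (hVi.const_mul _), integral_const_mul]
      linarith

end IsJointDensity

/-- The information density of a block of length `n` deviates from its mean by `O(√n)`. -/
lemma integral_abs_sum_infoDensity_sub_le [MeasurableSpace.CountableOrCountablyGenerated X Y]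
    (hI : mutualInfo μ κ ≠ ⊤) (h2 : MemLp (infoDensity μ κ) 2 (μ ⊗ₘ κ)) {n : ℕ} {N : ℝ}
    (hN : 0 < N) (hnN : n ≤ N ^ 2) :
    ∫ ω, |∑ i, infoDensity μ κ (ω i) - n * (mutualInfo μ κ).toReal|
      ∂(Measure.pi fun _ : Fin n => μ ⊗ₘ κ) ≤ N * (Var[infoDensity μ κ; μ ⊗ₘ κ] + 1) := by
  set P := Measure.pi fun _ : Fin n => μ ⊗ₘ κ with hP
  set J := (mutualInfo μ κ).toReal with hJ
  obtain ⟨-, hint, hmean⟩ := integrable_infoDensity hI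
  obtain ⟨hFi, hFI⟩ := integral_pi_sum hint n
  rw [hmean] at hFI
  have hmem : MemLp (fun ω : Fin n → X × Y => ∑ i, infoDensity μ κ (ω i)) 2 P :=
    memLp_finsetSum _ fun i _ => h2.comp_measurePreserving (measurePreserving_eval _ i)
  have hvar : ∫ ω, (∑ i, infoDensity μ κ (ω i) - n * J) ^ 2 ∂P
      = n * Var[infoDensity μ κ; μ ⊗ₘ κ] := by
    have h := variance_sum_pi (μ := fun _ : Fin n => μ ⊗ₘ κ) (X := fun _ => infoDensity μ κ)
      fun _ => h2
    rw [variance_eq_integral (by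
      refine AEMeasurable.congr hmem.aestronglyMeasurable.aemeasurable (ae_of_all _ fun ω => ?_)
      simp)] at h
    simp only [Finset.sum_apply, Finset.sum_const, Finset.card_univ, Fintype.card_fin,
      nsmul_eq_mul] at h
    rw [← h, hFI]
  have hsq : Integrable (fun ω : Fin n → X × Y =>
      (∑ i, infoDensity μ κ (ω i) - n * J) ^ 2) P :=
    (hmem.sub (memLp_const _)).integrable_sq
  have hv0 : 0 ≤ Var[infoDensity μ κ; μ ⊗ₘ κ] := variance_nonneg _ _
  calc _ ≤ ∫ ω, ((∑ i, infoDensity μ κ (ω i) - n * J) ^ 2 / N + N) ∂P := by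
        refine integral_mono (hFi.sub (integrable_const _)).abs
          ((hsq.div_const _).add (integrable_const _)) fun ω => ?_
        set t := ∑ i, infoDensity μ κ (ω i) - n * J
        change |t| ≤ t ^ 2 / N + N
        rw [← sub_le_iff_le_add, le_div_iff₀ hN, ← sq_abs t]
        nlinarith [sq_nonneg (|t| - N), abs_nonneg t]
    _ = n * Var[infoDensity μ κ; μ ⊗ₘ κ] / N + N := by
        rw [integral_add (hsq.div_const _) (integrable_const _), integral_div, hvar]
        simp
    _ ≤ N * Var[infoDensity μ κ; μ ⊗ₘ κ] + N := by
        gcongr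
        rw [div_le_iff₀ hN]
        nlinarith
    _ = _ := by ring

end BlockInformation

/-! ### Weights of the index codes -/

section Weights

lemma tsum_unpair (f : ℕ → ℕ → ℝ≥0∞) :
    ∑' i, f (Nat.unpair i).1 (Nat.unpair i).2 = ∑' k, ∑' m, f k m := by
  rw [← Nat.pairEquiv.tsum_eq]
  simp only [Nat.pairEquiv_apply, Function.uncurry_def, Nat.unpair_pair]
  exact ENNReal.tsum_prod (f := f)

lemma tsum_two_inv_pow : ∑' k : ℕ, ENNReal.ofReal ((2⁻¹ : ℝ) ^ k) = 2 := by
  simp_rw [ENNReal.ofReal_pow (show (0 : ℝ) ≤ 2⁻¹ by norm_num), ENNReal.tsum_geometric]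
  rw [ENNReal.ofReal_inv_of_pos two_pos, ENNReal.ofReal_ofNat, ENNReal.one_sub_inv_two, inv_inv]

/-- A code for pairs `(k, m)` in which `m` is compared with a scale `1 + 2 ^ k * p k`, for a
probability vector `p`. As `m` stays below the scale, `k` bits suffice up to a constant. -/
lemma exists_prefix_code_scaled (p : ℕ → ℝ) (hp : ∀ k, 0 ≤ p k)
    (hsum : ∑' k, ENNReal.ofReal (p k) ≤ 1) :
    ∃ C : ℕ → List Bool, (∀ i j, C i <+: C j → i = j) ∧ ∀ k m,
      ((C (Nat.pair k m)).length : ℝ) ≤ k + 2 * Real.logb 2 (1 + m / (1 + 2 ^ k * p k)) + 5 := by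
  set N : ℕ → ℝ := fun k => 1 + 2 ^ k * p k with hN
  have hN1 : ∀ k, 1 ≤ N k := fun k => by
    have := mul_nonneg (pow_nonneg zero_le_two k) (hp k)
    simp only [hN]; linarith
  have hN0 : ∀ k, 0 < N k := fun k => zero_lt_one.trans_le (hN1 k)
  set W : ℕ → ℕ → ℝ := fun k m => 8⁻¹ * (2⁻¹ ^ k * N k) * (N k / (N k + m) ^ 2) with hW
  have hden : ∀ k (m : ℕ), 0 < N k + m := fun k m =>
    add_pos_of_pos_of_nonneg (hN0 k) (Nat.cast_nonneg m)
  have hWpos : ∀ k m, 0 < W k m := fun k m => by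
    have := hN0 k; have := hden k m
    simp only [hW]; positivity
  obtain ⟨C, hC, hlen⟩ := exists_prefix_code
    (fun i => W (Nat.unpair i).1 (Nat.unpair i).2) (fun i => hWpos _ _) (by
      rw [tsum_unpair fun k m => ENNReal.ofReal (W k m)]
      calc ∑' k, ∑' m, ENNReal.ofReal (W k m)
          ≤ ∑' k, ENNReal.ofReal (8⁻¹ * (2⁻¹ ^ k * N k)) * 2 := by
            refine ENNReal.tsum_le_tsum fun k => ?_
            have h0 : 0 ≤ 8⁻¹ * ((2⁻¹ : ℝ) ^ k * N k) := by have := hN0 k; positivity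
            simp only [hW, ENNReal.ofReal_mul h0]
            rw [ENNReal.tsum_mul_left]
            gcongr
            exact tsum_div_add_sq_le_two _ (hN1 k)
        _ = ENNReal.ofReal (8⁻¹) * 2 *
              (∑' k, ENNReal.ofReal ((2⁻¹ : ℝ) ^ k) + ∑' k, ENNReal.ofReal (p k)) := by
            rw [← ENNReal.tsum_add, ← ENNReal.tsum_mul_left]
            refine tsum_congr fun k => ?_
            have h1 : (2⁻¹ : ℝ) ^ k * N k = 2⁻¹ ^ k + p k := by
              simp only [hN, mul_add, mul_one, ← mul_assoc, ← mul_pow]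
              norm_num
            rw [h1, ENNReal.ofReal_mul (by norm_num), ENNReal.ofReal_add (by positivity) (hp k)]
            ring
        _ ≤ ENNReal.ofReal (8⁻¹) * 2 * (2 + 1) := by
            rw [tsum_two_inv_pow]; gcongr
        _ = ENNReal.ofReal (8⁻¹ * 2 * (2 + 1)) := by
            rw [ENNReal.ofReal_mul (by norm_num), ENNReal.ofReal_mul (by norm_num),
              ENNReal.ofReal_add (by norm_num) (by norm_num)]
            simp
        _ ≤ 1 := ENNReal.ofReal_le_one.2 (by norm_num))
  refine ⟨C, hC, fun k m => ?_⟩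
  have h := hlen (Nat.pair k m)
  simp only [Nat.unpair_pair] at h
  have h0 := hN0 k
  have hd := hden k m
  have hW' : W k m = 8⁻¹ * 2⁻¹ ^ k * ((1 + m / N k)⁻¹) ^ 2 := by
    simp only [hW]
    field_simp
  have hpos : 0 < 1 + (m : ℝ) / N k := by positivity
  have h8 : Real.logb 2 8 = 3 := by
    rw [show (8 : ℝ) = 2 ^ 3 by norm_num, Real.logb_pow]; simp
  rw [hW', Real.logb_mul (by positivity) (by positivity), Real.logb_mul (by norm_num)
    (by positivity), Real.logb_pow, Real.logb_pow, Real.logb_inv, Real.logb_inv, Real.logb_inv,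
    h8, Real.logb_self_eq_one one_lt_two] at h
  push_cast at h
  linarith

/-- The `2 ^ l` integers `m` with `Nat.log 2 (m + 1) = l` share the weight `g l` equally. -/
lemma tsum_natLog_weight_le (g : ℕ → ℝ≥0∞) :
    ∑' m : ℕ, ENNReal.ofReal (2⁻¹ ^ Nat.log 2 (m + 1)) * g (Nat.log 2 (m + 1)) ≤ ∑' l, g l := by
  set f : ℕ → ℝ≥0∞ := fun m => ENNReal.ofReal (2⁻¹ ^ Nat.log 2 (m + 1)) * g (Nat.log 2 (m + 1))
  have key : ∀ M, ∑ m ∈ Finset.range (2 ^ M - 1), f m = ∑ l ∈ Finset.range M, g l := fun M => by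
    induction M with
    | zero => simp
    | succ M ih =>
      have hM : 1 ≤ 2 ^ M := Nat.one_le_two_pow
      have h1 : 2 ^ (M + 1) - 1 = (2 ^ M - 1) + 2 ^ M := by rw [pow_succ]; omega
      rw [h1, Finset.sum_range_add, ih, Finset.sum_range_succ]
      congr 1
      have h2 : ∀ i ∈ Finset.range (2 ^ M), f (2 ^ M - 1 + i) = ENNReal.ofReal (2⁻¹ ^ M) * g M :=
        fun i hi => by
          have hi' := Finset.mem_range.1 hi
          have h3 : Nat.log 2 (2 ^ M - 1 + i + 1) = M := by
            rw [Nat.log_eq_iff (Or.inr ⟨by norm_num, by omega⟩), pow_succ]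
            omega
          simp only [f, h3]
      rw [Finset.sum_congr rfl h2, Finset.sum_const, Finset.card_range, nsmul_eq_mul,
        ← mul_assoc]
      have h4 : ((2 ^ M : ℕ) : ℝ≥0∞) * ENNReal.ofReal (2⁻¹ ^ M) = 1 := by
        rw [← ENNReal.ofReal_natCast, ← ENNReal.ofReal_mul (Nat.cast_nonneg _)]
        push_cast
        rw [← mul_pow]; simp
      rw [h4, one_mul]
  refine ENNReal.tsum_le_of_sum_range_le fun M => ?_
  calc _ ≤ ∑ m ∈ Finset.range (2 ^ M - 1), f m :=
        Finset.sum_le_sum_of_subset (Finset.range_mono (by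
          have : M < 2 ^ M := Nat.lt_two_pow_self
          omega))
    _ = _ := key M
    _ ≤ _ := ENNReal.sum_le_tsum _

lemma tsum_comp_dist_le (f : ℕ → ℝ≥0∞) (a : ℕ) : ∑' l, f (Nat.dist l a) ≤ 2 * ∑' i, f i := by
  have h1 : ∀ l, f (Nat.dist l a)
      ≤ ∑' i, ((if l = a + i then f i else 0) + if l + i = a then f i else 0) := fun l => by
    refine le_trans ?_ (ENNReal.le_tsum (Nat.dist l a))
    rcases le_total a l with h | h
    · rw [if_pos (show l = a + Nat.dist l a by rw [Nat.dist_eq_sub_of_le_right h]; omega)]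
      exact le_self_add
    · rw [if_pos (show l + Nat.dist l a = a by rw [Nat.dist_eq_sub_of_le h]; omega)]
      exact le_add_self
  refine (ENNReal.tsum_le_tsum h1).trans ?_
  rw [ENNReal.tsum_comm, ← ENNReal.tsum_mul_left]
  refine ENNReal.tsum_le_tsum fun i => ?_
  rw [ENNReal.tsum_add, tsum_ite_eq, two_mul]
  gcongr
  by_cases h : i ≤ a
  · have : ∀ l, (if l + i = a then f i else 0) = if l = a - i then f i else 0 := fun l => by
      congr 1; apply propext; omega
    simp_rw [this, tsum_ite_eq]; exact le_rfl
  · have : ∀ l, (if l + i = a then f i else 0) = 0 := fun l => if_neg (by omega)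
    simp [this]

/-- A code for integers `m` whose logarithm is expected within `O(N)` of `a`: it needs
`log₂ m` bits, another `log₂ N` bits for locating `log₂ m`, and a constant. -/
lemma exists_prefix_code_concentrated (a : ℕ) (N : ℝ) (hN : 1 ≤ N) :
    ∃ C : ℕ → List Bool, (∀ i j, C i <+: C j → i = j) ∧ ∀ m : ℕ,
      ((C (Nat.pair 0 m)).length : ℝ) ≤ Nat.log 2 (m + 1) + Real.logb 2 N
        + 2 * Real.logb 2 (1 + |(Nat.log 2 (m + 1) : ℝ) - a| / N) + 5 := by
  have hN0 : 0 < N := by linarith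
  set V : ℕ → ℝ := fun d => N / (N + d) ^ 2 with hV
  have hden : ∀ d : ℕ, 0 < N + d := fun d => add_pos_of_pos_of_nonneg hN0 (Nat.cast_nonneg d)
  have hVpos : ∀ d, 0 < V d := fun d => by have := hden d; simp only [hV]; positivity
  set W : ℕ → ℕ → ℝ := fun k m =>
    8⁻¹ * 2⁻¹ ^ k * (2⁻¹ ^ Nat.log 2 (m + 1) * V (Nat.dist (Nat.log 2 (m + 1)) a)) with hW
  have hWpos : ∀ k m, 0 < W k m := fun k m => by
    have := hVpos (Nat.dist (Nat.log 2 (m + 1)) a)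
    simp only [hW]; positivity
  obtain ⟨C, hC, hlen⟩ := exists_prefix_code
    (fun i => W (Nat.unpair i).1 (Nat.unpair i).2) (fun i => hWpos _ _) (by
      rw [tsum_unpair fun k m => ENNReal.ofReal (W k m)]
      calc ∑' k, ∑' m, ENNReal.ofReal (W k m)
          ≤ ∑' k : ℕ, ENNReal.ofReal (8⁻¹ * 2⁻¹ ^ k) * 4 := by
            refine ENNReal.tsum_le_tsum fun k => ?_
            have h0 : 0 ≤ 8⁻¹ * (2⁻¹ : ℝ) ^ k := by positivity
            simp only [hW, ENNReal.ofReal_mul h0]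
            rw [ENNReal.tsum_mul_left]
            gcongr
            have h1 : ∀ l, (0 : ℝ) ≤ 2⁻¹ ^ l := fun l => by positivity
            simp only [ENNReal.ofReal_mul (h1 _)]
            refine (tsum_natLog_weight_le fun l => ENNReal.ofReal (V (Nat.dist l a))).trans ?_
            refine (tsum_comp_dist_le (fun d => ENNReal.ofReal (V d)) a).trans ?_
            calc _ ≤ (2 : ℝ≥0∞) * 2 := by gcongr; exact tsum_div_add_sq_le_two N hN
              _ = 4 := by norm_num
        _ = ENNReal.ofReal 8⁻¹ * 4 * ∑' k, ENNReal.ofReal ((2⁻¹ : ℝ) ^ k) := by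
            rw [← ENNReal.tsum_mul_left]
            refine tsum_congr fun k => ?_
            rw [ENNReal.ofReal_mul (by norm_num)]; ring
        _ = ENNReal.ofReal (8⁻¹ * 4 * 2) := by
            rw [tsum_two_inv_pow, ENNReal.ofReal_mul (by norm_num),
              ENNReal.ofReal_mul (by norm_num)]
            simp
        _ ≤ 1 := ENNReal.ofReal_le_one.2 (by norm_num))
  refine ⟨C, hC, fun m => ?_⟩
  have h := hlen (Nat.pair 0 m)
  simp only [Nat.unpair_pair] at h
  set l := Nat.log 2 (m + 1) with hl
  have hdist : ((Nat.dist l a : ℕ) : ℝ) = |(l : ℝ) - a| := by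
    rcases le_total a l with h | h
    · rw [Nat.dist_eq_sub_of_le_right h, Nat.cast_sub h, abs_of_nonneg]
      rw [sub_nonneg]; exact_mod_cast h
    · rw [Nat.dist_eq_sub_of_le h, Nat.cast_sub h, abs_of_nonpos, neg_sub]
      rw [sub_nonpos]; exact_mod_cast h
  have hW' : W 0 m = 8⁻¹ * 2⁻¹ ^ l * (N⁻¹ * ((1 + |(l : ℝ) - a| / N)⁻¹) ^ 2) := by
    have := hden (Nat.dist l a)
    simp only [hW, hV, ← hl, ← hdist]
    field_simp
  have hpos : 0 < 1 + |(l : ℝ) - a| / N := by positivity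
  have h8 : Real.logb 2 8 = 3 := by
    rw [show (8 : ℝ) = 2 ^ 3 by norm_num, Real.logb_pow]; simp
  rw [hW', Real.logb_mul (by positivity) (by positivity), Real.logb_mul (by norm_num)
    (by positivity), Real.logb_mul (by positivity) (by positivity), Real.logb_pow, Real.logb_pow,
    Real.logb_inv, Real.logb_inv, Real.logb_inv, Real.logb_inv,
    h8, Real.logb_self_eq_one one_lt_two] at h
  push_cast at h
  linarith

end Weights

/-! ### Bounds on the normalized redundancy -/

section Rates

lemma normRedundancy_le {X : Type u} {Y : Type v} [MeasurableSpace X] [MeasurableSpace Y]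
    {μ : Measure X} {κ : Kernel X Y} (hI : mutualInfo μ κ ≠ ⊤) {n : ℕ} (hn : 2 ≤ n) {D : ℝ} (hD : 0 ≤ D)
    (h : minRate μ κ n ≤ ENNReal.ofReal (n * (mutualInfo μ κ).toReal + D) / n) :
    normRedundancy μ κ n ≤ ((D / Real.logb 2 n : ℝ) : EReal) := by
  set J := (mutualInfo μ κ).toReal with hJ
  have hJ0 : 0 ≤ J := ENNReal.toReal_nonneg
  have hn0 : (0 : ℝ) < n := by exact_mod_cast (by omega : 0 < n)
  have hlog : 0 < Real.logb 2 n :=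
    Real.logb_pos one_lt_two (by exact_mod_cast (by omega : 1 < n))
  have h1 : (minRate μ κ n : EReal) ≤ ((J + D / n : ℝ) : EReal) := by
    have e : ENNReal.ofReal (n * J + D) / n = ENNReal.ofReal (J + D / n) := by
      rw [← ENNReal.ofReal_natCast, ← ENNReal.ofReal_div_of_pos hn0]
      congr 1; field_simp
    rw [e] at h
    refine (EReal.coe_ennreal_le_coe_ennreal_iff.2 h).trans ?_
    rw [EReal.coe_ennreal_ofReal, max_eq_left (by positivity)]
  have h2 : (mutualInfo μ κ : EReal) = (J : EReal) := by
    rw [hJ, EReal.coe_ennreal_toReal hI]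
  unfold normRedundancy
  calc _ ≤ (((J + D / n : ℝ) : EReal) - (J : EReal)) / ((Real.logb 2 n / n : ℝ) : EReal) := by
        refine EReal.div_le_div_right_of_nonneg (by exact_mod_cast (by positivity)) ?_
        rw [h2]
        exact EReal.sub_le_sub h1 le_rfl
    _ = (((J + D / n - J) / (Real.logb 2 n / n) : ℝ) : EReal) := by
        rw [← EReal.coe_sub, ← EReal.coe_div]
    _ = _ := by
        congr 1
        field_simp
        ring

variable {X : Type u} {Y : Type v} [MeasurableSpace X] [MeasurableSpace Y]
  [MeasurableSpace.CountableOrCountablyGenerated X Y]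
variable {μ : Measure X} [IsProbabilityMeasure μ] {κ : Kernel X Y} [IsMarkovKernel κ]

/-- In the singular case the level of an output block bounds its density within a factor two, so
that a level and a position within the level cost no more than the information density, up to a
constant. -/
lemma minRate_le_of_isSingular (hI : mutualInfo μ κ ≠ ⊤) (hs : IsSingular μ κ) (n : ℕ) :
    minRate μ κ n ≤ ENNReal.ofReal (n * (mutualInfo μ κ).toReal + 29) / n := by
  classical
  obtain ⟨h, hhm, hh⟩ := hs
  obtain ⟨r, hr, hir⟩ := exists_isJointDensity (integrable_infoDensity hI).1
  set lev : (Fin n → Y) → ℕ := fun y => ⌊∑ i, h (y i)⌋₊ with hlevdef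
  have hlev : Measurable lev := Nat.measurable_floor.comp
    (Finset.measurable_sum _ fun i _ => hhm.comp (measurable_pi_apply i))
  set Q : Measure (Fin n → Y) := Measure.pi fun _ : Fin n => κ ∘ₘ μ with hQ
  set p : ℕ → ℝ := fun k => (Q (lev ⁻¹' {k})).toReal with hp
  have hp0 : ∀ k, 0 ≤ p k := fun k => ENNReal.toReal_nonneg
  have hpQ : ∀ k, ENNReal.ofReal (p k) = Q (lev ⁻¹' {k}) := fun k =>
    ENNReal.ofReal_toReal (measure_ne_top _ _)
  obtain ⟨C, hC, hlen⟩ := exists_prefix_code_scaled p hp0 (by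
    simp_rw [hpQ]
    rw [← measure_iUnion (fun i j hij => Disjoint.preimage _ (by simpa using hij))
      fun k => hlev (measurableSet_singleton k)]
    exact prob_le_one)
  -- only almost every pair of blocks has its density tied to its level
  set a : (Fin n → X) → (Fin n → Y) → ℝ≥0∞ := fun x y =>
    if blockDensity r n x y ≤ 2 ^ (lev y + 1) then ENNReal.ofReal (lev y + 9) else ⊤ with ha
  have ham : Measurable (Function.uncurry a) := by
    have hl : Measurable fun p : (Fin n → X) × (Fin n → Y) => lev p.2 := hlev.comp measurable_snd
    refine Measurable.ite (measurableSet_le (measurable_blockDensity hr.measurable n) ?_) ?_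
      measurable_const
    · exact (measurable_from_top (f := fun l : ℕ => (2 : ℝ≥0∞) ^ (l + 1))).comp hl
    · exact (measurable_from_top (f := fun l : ℕ => ENNReal.ofReal (l + 9))).comp hl
  refine (minRate_le hr n hlev hC ham (b := 9) (by norm_num) ?_).trans ?_
  · intro x y m s hs0 hs1 hm
    by_cases hxy : blockDensity r n x y ≤ 2 ^ (lev y + 1)
    · simp only [ha, if_pos hxy]
      rw [← ENNReal.ofReal_natCast, ← ENNReal.ofReal_add (by positivity) (by positivity)]
      refine ENNReal.ofReal_le_ofReal ((hlen _ _).trans ?_)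
      set N := 1 + 2 ^ lev y * p (lev y) with hN
      have hN1 : 1 ≤ N := by
        have := mul_nonneg (pow_nonneg zero_le_two (lev y)) (hp0 (lev y))
        linarith
      have hm' : s * m ≤ 2 * N := by
        have h1 := hm.trans (mul_le_mul_left hxy _)
        rw [← hpQ, ← ENNReal.ofReal_natCast, ← ENNReal.ofReal_mul hs0.le,
          show (2 : ℝ≥0∞) ^ (lev y + 1) = ENNReal.ofReal (2 ^ (lev y + 1)) by
            rw [ENNReal.ofReal_pow zero_le_two]; simp,
          ← ENNReal.ofReal_mul (by positivity),
          ENNReal.ofReal_le_ofReal_iff (mul_nonneg (by positivity) (hp0 _)), pow_succ] at h1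
        rw [hN]; linarith
      have h2 : 1 + m / N ≤ 4 * s⁻¹ := by
        have h3 : (m : ℝ) / N ≤ 2 * s⁻¹ := by
          rw [div_le_iff₀ (by linarith), mul_right_comm, ← div_eq_mul_inv, le_div_iff₀ hs0]
          linarith
        have h4 : 1 ≤ s⁻¹ := (one_le_inv₀ hs0).2 hs1
        linarith
      have h5 : Real.logb 2 (1 + m / N) ≤ 2 + 3 / √s := by
        refine (Real.logb_le_logb_of_le one_lt_two (by positivity) h2).trans ?_
        rw [Real.logb_mul (by norm_num) (by positivity), Real.logb_inv,
          show (4 : ℝ) = 2 ^ 2 by norm_num, Real.logb_pow, Real.logb_self_eq_one one_lt_two]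
        have := neg_logb_two_le_div_sqrt hs0
        push_cast; linarith
      have h6 : 9 / √s = 3 * (3 / √s) := by ring
      have h7 : 0 ≤ 3 / √s := by positivity
      linarith
    · simp only [ha, if_neg hxy, top_add]; exact le_top
  · refine ENNReal.div_le_div_right ?_ _
    have hae : ∀ᵐ ω ∂(Measure.pi fun _ : Fin n => μ ⊗ₘ κ),
        a (fun i => (ω i).1) (fun i => (ω i).2) ≤
        ENNReal.ofReal (blockLog r n (fun i => (ω i).1) (fun i => (ω i).2)) +
          ENNReal.ofReal 9 := by
      filter_upwards [hr.ae_blockLog hir n, ae_pi_forall hh n] with ω hω hω'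
      set R := blockDensity r n (fun i => (ω i).1) (fun i => (ω i).2) with hR
      have hF : Real.logb 2 R.toReal = ∑ i, h (ω i).2 := by
        rw [hω.2.1]; exact Finset.sum_congr rfl fun i _ => hω' i
      have hRt : R ≠ ⊤ := ENNReal.prod_ne_top fun i _ => hr.ne_top _ _
      have hle : R ≤ 2 ^ (lev (fun i => (ω i).2) + 1) := by
        have h1 : Real.logb 2 R.toReal ≤ ((lev (fun i => (ω i).2) + 1 : ℕ) : ℝ) := by
          rw [hF]; push_cast; exact (Nat.lt_floor_add_one _).le
        rw [Real.logb_le_iff_le_rpow one_lt_two hω.1, Real.rpow_natCast] at h1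
        rw [← ENNReal.ofReal_toReal hRt]
        refine (ENNReal.ofReal_le_ofReal h1).trans ?_
        rw [ENNReal.ofReal_pow zero_le_two]; simp
      have haω : a (fun i => (ω i).1) (fun i => (ω i).2)
          = ENNReal.ofReal (lev (fun i => (ω i).2) + 9) := if_pos hle
      rw [haω, ENNReal.ofReal_add (Nat.cast_nonneg _) (by norm_num)]
      gcongr
      rcases le_total 0 (∑ i, h (ω i).2) with h0 | h0
      · refine (Nat.floor_le h0).trans ?_
        rw [← hF, hω.2.1]; exact hω.2.2.1
      · simp only [hlevdef, Nat.floor_of_nonpos h0, Nat.cast_zero]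
        exact blockLog_nonneg _ _ _ _
    calc _ ≤ ∫⁻ ω, (ENNReal.ofReal (blockLog r n (fun i => (ω i).1) (fun i => (ω i).2)) +
          ENNReal.ofReal 9) ∂(Measure.pi fun _ : Fin n => μ ⊗ₘ κ) + ENNReal.ofReal (2 * 9) := by
          gcongr ?_ + _; exact lintegral_mono_ae hae
      _ ≤ ENNReal.ofReal (n * (mutualInfo μ κ).toReal + 2) + ENNReal.ofReal 9 +
          ENNReal.ofReal (2 * 9) := by
          rw [lintegral_add_right _ measurable_const]
          gcongr
          · exact (hr.lintegral_blockLog_le hir hI n).1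
          · simp
      _ = _ := by
          rw [← ENNReal.ofReal_add (by positivity) (by norm_num),
            ← ENNReal.ofReal_add (by positivity) (by norm_num)]
          congr 1; ring

/-- In general the logarithm of the index concentrates within `O(√n)` of the mutual information of
the block, so that locating it costs `log₂ √n` bits. -/
lemma minRate_le_of_memLp (hI : mutualInfo μ κ ≠ ⊤)
    (h2 : MemLp (infoDensity μ κ) 2 (μ ⊗ₘ κ)) (n : ℕ) :
    minRate μ κ n ≤ ENNReal.ofReal (n * (mutualInfo μ κ).toReal + (Real.logb 2 (√n + 3) +
      (3 * Var[infoDensity μ κ; μ ⊗ₘ κ] + 40))) / n := by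
  obtain ⟨r, hr, hir⟩ := exists_isJointDensity (integrable_infoDensity hI).1
  set J := (mutualInfo μ κ).toReal with hJ
  have hJ0 : 0 ≤ J := ENNReal.toReal_nonneg
  set N : ℝ := √n + 3 with hN
  have hN3 : 3 ≤ N := by have := Real.sqrt_nonneg n; linarith
  have hN0 : 0 < N := by linarith
  have hlogN : 0 ≤ Real.logb 2 N := Real.logb_nonneg one_lt_two (by linarith)
  have hnN : (n : ℝ) ≤ N ^ 2 := by
    have h1 := Real.sq_sqrt (Nat.cast_nonneg (α := ℝ) n)
    have h2 := Real.sqrt_nonneg n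
    nlinarith
  -- the code measures deviations from an integer
  set k₀ := ⌊n * J⌋₊ with hk₀
  have hk : |(n : ℝ) * J - k₀| ≤ 1 := by
    have h1 := Nat.floor_le (show 0 ≤ n * J by positivity)
    have h2 := Nat.lt_floor_add_one (n * J)
    rw [abs_le]; constructor <;> linarith
  obtain ⟨C, hC, hlen⟩ := exists_prefix_code_concentrated k₀ N (by linarith)
  set L := blockLog r n with hL
  have hL0 : ∀ x y, 0 ≤ L x y := blockLog_nonneg r n
  set a : (Fin n → X) → (Fin n → Y) → ℝ≥0∞ := fun x y =>
    ENNReal.ofReal (L x y) + ENNReal.ofReal (3 / N) * ENNReal.ofReal |L x y - n * J| +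
      ENNReal.ofReal (Real.logb 2 N + 6) with ha
  have hLm : Measurable (Function.uncurry L) := measurable_blockLog hr.measurable n
  have ham : Measurable (Function.uncurry a) :=
    (hLm.ennreal_ofReal.add (((hLm.sub_const _).abs).ennreal_ofReal.const_mul _)).add_const _
  refine (minRate_le hr n (lev := fun _ => 0) measurable_const hC ham (b := 6) (by norm_num)
    ?_).trans ?_
  · intro x y m s hs0 hs1 hm
    have hRt : blockDensity r n x y ≠ ⊤ := ENNReal.prod_ne_top fun i _ => hr.ne_top _ _
    simp only [ha]
    rw [← ENNReal.ofReal_natCast, ← ENNReal.ofReal_mul (by positivity),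
      ← ENNReal.ofReal_add (hL0 x y) (by positivity),
      ← ENNReal.ofReal_add (add_nonneg (hL0 x y) (by positivity)) (by positivity),
      ← ENNReal.ofReal_add (add_nonneg (add_nonneg (hL0 x y) (by positivity)) (by positivity))
        (by positivity)]
    refine ENNReal.ofReal_le_ofReal ((hlen _).trans ?_)
    set l : ℝ := (Nat.log 2 (m + 1) : ℝ) with hl
    set ls : ℝ := - Real.logb 2 s with hls
    have hls0 : 0 ≤ ls := by
      have := Real.logb_nonpos one_lt_two hs0.le hs1; linarith
    -- the index is at most `(1 + R) / s`
    have hlle : l ≤ L x y + ls := by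
      have h1 : s * m ≤ (blockDensity r n x y).toReal := by
        have h3 : ENNReal.ofReal s * m ≤ blockDensity r n x y := by simpa using hm
        rw [← ENNReal.ofReal_natCast, ← ENNReal.ofReal_mul hs0.le,
          ENNReal.ofReal_le_iff_le_toReal hRt] at h3
        exact h3
      have h4 : ((m + 1 : ℕ) : ℝ) ≤ (1 + (blockDensity r n x y).toReal) * s⁻¹ := by
        rw [← div_eq_mul_inv, le_div_iff₀ hs0]
        push_cast; linarith
      have h5 : l ≤ Real.logb 2 ((m + 1 : ℕ) : ℝ) := by
        rw [Real.le_logb_iff_rpow_le one_lt_two (by positivity), hl, Real.rpow_natCast]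
        exact_mod_cast Nat.pow_log_le_self 2 (Nat.succ_ne_zero m)
      refine h5.trans ((Real.logb_le_logb_of_le one_lt_two (by positivity) h4).trans ?_)
      have h6 : 0 < 1 + (blockDensity r n x y).toReal := by
        have := ENNReal.toReal_nonneg (a := blockDensity r n x y); linarith
      rw [Real.logb_mul h6.ne' (by positivity), Real.logb_inv]
      exact le_rfl
    have hdev : |l - k₀| ≤ |L x y - n * J| + 1 + ls + (L x y + ls - l) := by
      have t1 : l - k₀ = (L x y - n * J) + (n * J - k₀) + ls - (L x y + ls - l) := by ring
      rw [t1, abs_le]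
      have := abs_le.1 hk
      have a1 := neg_abs_le (L x y - n * J)
      have a2 := le_abs_self (L x y - n * J)
      constructor <;> linarith
    have hlog1 : 2 * Real.logb 2 (1 + |l - k₀| / N) ≤ 3 / N * |l - k₀| := by
      have := logb_two_one_add_le (show 0 ≤ |l - k₀| / N by positivity)
      calc _ ≤ 2 * (3 / 2 * (|l - k₀| / N)) := by linarith
        _ = _ := by ring
    -- as `3 / N ≤ 1`, the cost is monotone in `l` and may be evaluated at the upper bound
    have h3N : 3 / N ≤ 1 := by rw [div_le_one hN0]; exact hN3
    have h3N0 : 0 ≤ 3 / N := by positivity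
    have hrest : 0 ≤ 1 + ls + (L x y + ls - l) := by linarith
    have hlog2 : 3 / N * |l - k₀| ≤ 3 / N * |L x y - n * J| + (1 + ls + (L x y + ls - l)) := by
      calc _ ≤ 3 / N * (|L x y - n * J| + (1 + ls + (L x y + ls - l))) := by
            gcongr; linarith
        _ ≤ _ := by
            rw [mul_add]
            gcongr
            exact mul_le_of_le_one_left hrest h3N
    have h6 : 6 / √s = 2 * (3 / √s) := by ring
    have h7 : ls ≤ 3 / √s := neg_logb_two_le_div_sqrt hs0
    linarith
  · refine ENNReal.div_le_div_right ?_ _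
    obtain ⟨hb1, hb2⟩ := hr.lintegral_blockLog_le hir hI n
    have hv := integral_abs_sum_infoDensity_sub_le hI h2 hN0 hnN
    set v := Var[infoDensity μ κ; μ ⊗ₘ κ] with hvdef
    have hv0 : 0 ≤ v := variance_nonneg _ _
    have hm1 : Measurable fun ω : Fin n → X × Y => L (fun i => (ω i).1) (fun i => (ω i).2) :=
      show Measurable (Function.uncurry L ∘ fun ω : Fin n → X × Y =>
      ((fun i => (ω i).1, fun i => (ω i).2) : (Fin n → X) × (Fin n → Y))) from
        hLm.comp (measurable_unzip n)
    have hb3 : ENNReal.ofReal (3 / N) * ∫⁻ ω, ENNReal.ofReal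
        |L (fun i => (ω i).1) (fun i => (ω i).2) - n * J| ∂(Measure.pi fun _ : Fin n => μ ⊗ₘ κ)
        ≤ ENNReal.ofReal (3 * v + 5) := by
      refine (mul_le_mul_right hb2 _).trans ?_
      rw [← ENNReal.ofReal_mul (by positivity)]
      refine ENNReal.ofReal_le_ofReal ?_
      calc _ ≤ 3 / N * (N * (v + 1) + 2) := by gcongr
        _ = 3 * (v + 1) + 3 / N * 2 := by field_simp
        _ ≤ _ := by
          have h3N : 3 / N ≤ 1 := by rw [div_le_one hN0]; exact hN3
          linarith
    simp only [ha]
    rw [lintegral_add_right _ measurable_const, lintegral_add_left hm1.ennreal_ofReal,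
      lintegral_const_mul _ ((hm1.sub_const _).abs).ennreal_ofReal]
    calc _ ≤ ENNReal.ofReal (n * J + 2) + ENNReal.ofReal (3 * v + 5) +
          ENNReal.ofReal (Real.logb 2 N + 6) + ENNReal.ofReal (2 * 6) := by
          gcongr
          simp
      _ = ENNReal.ofReal (n * J + 2 + (3 * v + 5) + (Real.logb 2 N + 6) + 2 * 6) := by
          rw [← ENNReal.ofReal_add (by positivity) (by positivity),
            ← ENNReal.ofReal_add (by positivity) (by positivity),
            ← ENNReal.ofReal_add (by positivity) (by positivity)]
      _ ≤ _ := ENNReal.ofReal_le_ofReal (by linarith)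

lemma normRedundancy_nonneg (hI : mutualInfo μ κ ≠ ⊤) {n : ℕ} (hn : 2 ≤ n) :
    0 ≤ normRedundancy μ κ n := by
  have h : mutualInfo μ κ ≤ minRate μ κ n :=
    le_iInf₂ fun c hc => c.mutualInfo_le_rate (by omega) hI hc
  have hlog : 0 ≤ Real.logb 2 n :=
    Real.logb_nonneg one_lt_two (by exact_mod_cast (by omega : 1 ≤ n))
  refine EReal.div_nonneg ?_ (by exact_mod_cast (by positivity))
  rw [EReal.sub_nonneg (by simp [hI]) (by simp)]
  exact EReal.coe_ennreal_le_coe_ennreal_iff.2 h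

end Rates

lemma tendsto_logb_two_natCast : Tendsto (fun n : ℕ => Real.logb 2 n) atTop atTop :=
  (Real.tendsto_logb_atTop one_lt_two).comp tendsto_natCast_atTop_atTop

end ChannelSynthesis
end

open ChannelSynthesis in
theorem theorem1 {X : Type*} {Y : Type*}
    [TopologicalSpace X] [PolishSpace X] [MeasurableSpace X] [BorelSpace X]
    [TopologicalSpace Y] [PolishSpace Y] [MeasurableSpace Y] [BorelSpace Y]
    (μ : Measure X) [IsProbabilityMeasure μ] (κ : Kernel X Y) [IsMarkovKernel κ]
    (hI : ChannelSynthesis.mutualInfo μ κ ≠ ⊤) :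
    (ChannelSynthesis.IsSingular μ κ →
      Tendsto (fun n : ℕ => ChannelSynthesis.normRedundancy μ κ n) atTop (𝓝 0)) ∧
    (¬ ChannelSynthesis.IsSingular μ κ →
      MemLp (ChannelSynthesis.infoDensity μ κ) 2 (μ ⊗ₘ κ) →
      limsup (fun n : ℕ => ChannelSynthesis.normRedundancy μ κ n) atTop ≤ ((1 / 2 : ℝ) : EReal)) := by
  constructor
  · intro hs
    have hup : Tendsto (fun n : ℕ => ((29 / Real.logb 2 n : ℝ) : EReal)) atTop (𝓝 0) :=
      (continuous_coe_real_ereal.tendsto 0).comp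
        (tendsto_const_nhds.div_atTop tendsto_logb_two_natCast)
    refine tendsto_of_tendsto_of_tendsto_of_le_of_le' tendsto_const_nhds hup ?_ ?_
    · filter_upwards [eventually_ge_atTop 2] with n hn using normRedundancy_nonneg hI hn
    · filter_upwards [eventually_ge_atTop 2] with n hn using
        normRedundancy_le hI hn (by norm_num) (minRate_le_of_isSingular hI hs n)
  · intro _ h2
    set v := Var[infoDensity μ κ; μ ⊗ₘ κ] with hv
    have hv0 : 0 ≤ v := variance_nonneg _ _
    have hlim : Tendsto (fun n : ℕ => ((1 / 2 + (3 * v + 42) / Real.logb 2 n : ℝ) : EReal)) atTop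
        (𝓝 ((1 / 2 : ℝ) : EReal)) := by
      have h := (tendsto_const_nhds (x := (1 / 2 : ℝ))).add
        ((tendsto_const_nhds (x := 3 * v + 42)).div_atTop tendsto_logb_two_natCast)
      rw [add_zero] at h
      exact (continuous_coe_real_ereal.tendsto _).comp h
    rw [← hlim.limsup_eq]
    refine limsup_le_limsup ?_
    filter_upwards [eventually_ge_atTop 2] with n hn
    have hn1 : (1 : ℝ) ≤ n := by exact_mod_cast (by omega : 1 ≤ n)
    have hlog : 0 < Real.logb 2 n :=
      Real.logb_pos one_lt_two (by exact_mod_cast (by omega : 1 < n))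
    have hs1 : 1 ≤ √(n : ℝ) := Real.one_le_sqrt.2 hn1
    have hs0 : 0 ≤ Real.logb 2 (√n + 3) := Real.logb_nonneg one_lt_two (by linarith)
    refine (normRedundancy_le hI hn (by positivity) (minRate_le_of_memLp hI h2 n)).trans ?_
    rw [EReal.coe_le_coe_iff, div_le_iff₀ hlog, add_mul, div_mul_cancel₀ _ hlog.ne']
    have h3 : Real.logb 2 (√n + 3) ≤ 2 + 1 / 2 * Real.logb 2 n := by
      calc _ ≤ Real.logb 2 (4 * √n) :=
            Real.logb_le_logb_of_le one_lt_two (by linarith) (by linarith)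
        _ = _ := by
          rw [Real.logb_mul (by norm_num) (by positivity), show (4 : ℝ) = 2 ^ 2 by norm_num,
            Real.logb_pow, Real.logb_self_eq_one one_lt_two, Real.sqrt_eq_rpow,
            Real.logb_rpow_eq_mul_logb_of_pos (by positivity)]
          norm_num
    linarith
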